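/- Let $(X,\mu)$ be a standard Borel space with a non-atomic Borel probability measure, and let $\mathrm{Aut}(X,\mu)$ be the group of $\mu$-preserving Borel bijections of $X$, two of them being identified when they agree almost everywhere. A graphing $\Phi$ is a countable set of measure-preserving Borel bijections $\varphi:\mathrm{dom}\,\varphi\to\mathrm{rng}\,\varphi$ between Borel subsets of $X$. Let $\mathcal R_\Phi$ be the smallest equivalence relation on $X$ containing all pairs $(x,\varphi(x))$ with $\varphi\in\Phi$, $x\in\mathrm{dom}\,\varphi$; the graphing $\Phi$ is aperiodic if almost every $\mathcal R_\Phi$-class is infinite. For $(x,y)\in\mathcal R_\Phi$ let $d_\Phi(x,y)$ be the least $n\in\mathbb N$ such that $y=\varphi_n\cdots\varphi_1(x)$ for some $\varphi_1,\dots,\varphi_n\in\Phi\cup\Phi^{-1}$. The $\mathrm L^1$ full group of $\Phi$ is $$[\Phi]_1=\Big\{T\in\mathrm{Aut}(X,\mu):\ (x,T(x))\in\mathcal R_\Phi\text{ for almost every }x,\ \int_X d_\Phi(x,T(x))\,d\mu(x)<\infty\Big\},$$ with the topology given by the metric $\tilde d_\Phi(S,T)=\int_X d_\Phi(S(x),T(x))\,d\mu(x)$.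 Let $D([\Phi]_1)$ be its derived group, i.e. its commutator subgroup. An involution is an element $U$ with $U^2=\mathrm{id}$. For $T\in\mathrm{Aut}(X,\mu)$ and $A\subseteq X$ Borel, the induced transformation $T_A$ is given, for almost every $x$, by $T_A(x)=T^{n}(x)$ with $n\ge 1$ least such that $T^n(x)\in A$ if $x\in A$, and $T_A(x)=x$ if $x\notin A$. Suppose that $\Phi$ is aperiodic. Then: 1. The closure $\overline{D([\Phi]_1)}$ in $[\Phi]_1$ is topologically generated by involutions: it is equal to the closure of the subgroup of $[\Phi]_1$ generated by all involutions of $[\Phi]_1$. 2. $\overline{D([\Phi]_1)}$ is connected. 3. For every involution $U\in[\Phi]_1$ there is a continuous path $(U_t)_{t\in[0,1]}$ in $[\Phi]_1$ with $U_0=\mathrm{id}$ and $U_1=U$ such that each $U_t$ is an involution of the form $U_{A_t}$, the transformation induced by $U$ on some Borel set $A_t\subseteq X$. -/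

import Mathlib

open MeasureTheory Set
open scoped ENNReal

namespace L1Full

variable {X : Type*} [MeasurableSpace X]

/-- The measure-preserving transformations of `(X, μ)`: Borel bijections `X → X` (with Borel
inverse) preserving `μ`, before identification modulo null sets. -/
def mpPerm (μ : Measure X) : Subgroup (Equiv.Perm X) where
  carrier := {f | MeasurePreserving f μ μ ∧ MeasurePreserving f.symm μ μ}
  mul_mem' := fun ha hb => ⟨ha.1.comp hb.1, hb.2.comp ha.2⟩
  one_mem' := ⟨MeasurePreserving.id μ, MeasurePreserving.id μ⟩
  inv_mem' := fun ha => ⟨ha.2, ha.1⟩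

/-- The transformations that coincide with the identity up to measure zero. -/
def aeId (μ : Measure X) : Subgroup (mpPerm μ) where
  carrier := {f | ∀ᵐ x ∂μ, f.1 x = x}
  mul_mem' := by
    intro a b ha hb
    filter_upwards [(show ∀ᵐ x ∂μ, a.1 x = x from ha), (show ∀ᵐ x ∂μ, b.1 x = x from hb)]
      with x h1 h2
    simp [h1, h2]
  one_mem' := by simp
  inv_mem' := by
    intro a ha
    filter_upwards [(show ∀ᵐ x ∂μ, a.1 x = x from ha)] with x h1
    show a.1.symm x = x
    rw [Equiv.symm_apply_eq, h1]

instance (μ : Measure X) : (aeId μ).Normal where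
  conj_mem := by
    intro a ha g
    have h : ∀ᵐ x ∂μ, a.1 x = x := ha
    have h' := g.2.2.quasiMeasurePreserving.ae h
    filter_upwards [h'] with x hx
    show g.1 (a.1 (g.1.symm x)) = x
    rw [hx, Equiv.apply_symm_apply]

/-- The group `Aut(X, μ)`: measure-preserving transformations, two of them being identified
when they coincide up to measure zero. -/
abbrev MAut (μ : Measure X) : Type _ := mpPerm μ ⧸ aeId μ

/-- A representative of an element of `Aut(X, μ)`, as a permutation of `X`. It is determined up
to a null set, and is only used in statements that are insensitive to null sets. -/
noncomputable def MAut.perm {μ : Measure X} (T : MAut μ) : Equiv.Perm X :=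
  (Quotient.out T).1

noncomputable instance (μ : Measure X) : CoeFun (MAut μ) (fun _ => X → X) :=
  ⟨fun T => T.perm⟩

section
variable {μ : Measure X}

theorem MAut.mp (T : MAut μ) : MeasurePreserving T μ μ := (Quotient.out T).2.1

theorem MAut.mp_symm (T : MAut μ) : MeasurePreserving T.perm.symm μ μ := (Quotient.out T).2.2

theorem MAut.mk_ae (f : mpPerm μ) : ∀ᵐ x ∂μ, (QuotientGroup.mk f : MAut μ) x = f.1 x := by
  have h : (QuotientGroup.mk (Quotient.out (QuotientGroup.mk f : MAut μ)) : MAut μ)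
      = QuotientGroup.mk f := Quotient.out_eq _
  have h2 : f⁻¹ * Quotient.out (QuotientGroup.mk f : MAut μ) ∈ aeId μ :=
    QuotientGroup.eq.1 h.symm
  have h3 : ∀ᵐ x ∂μ, f.1.symm ((QuotientGroup.mk f : MAut μ) x) = x := h2
  filter_upwards [h3] with x hx
  rwa [Equiv.symm_apply_eq] at hx

theorem MAut.ext_ae {S T : MAut μ} (h : ∀ᵐ x ∂μ, S x = T x) : S = T := by
  rw [← Quotient.out_eq S, ← Quotient.out_eq T]
  refine QuotientGroup.eq.2 ?_
  show ∀ᵐ x ∂μ, S.perm.symm (T x) = x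
  filter_upwards [h] with x hx
  rw [← hx]
  exact Equiv.symm_apply_apply _ _

theorem MAut.one_ae : ∀ᵐ x ∂μ, (1 : MAut μ) x = x := MAut.mk_ae (1 : mpPerm μ)

theorem MAut.mul_ae (S T : MAut μ) : ∀ᵐ x ∂μ, (S * T) x = S (T x) := by
  have h : S * T = QuotientGroup.mk (Quotient.out S * Quotient.out T) := by
    rw [QuotientGroup.mk_mul]
    exact congrArg₂ (· * ·) (Quotient.out_eq S).symm (Quotient.out_eq T).symm
  rw [h]
  exact MAut.mk_ae _

theorem MAut.inv_ae (T : MAut μ) : ∀ᵐ x ∂μ, (T⁻¹) x = T.perm.symm x := by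
  have h : T⁻¹ = QuotientGroup.mk (Quotient.out T)⁻¹ := by
    rw [QuotientGroup.mk_inv]
    exact congrArg (·⁻¹) (Quotient.out_eq T).symm
  rw [h]
  exact MAut.mk_ae _

end

/-- `V` is the transformation `T_A` induced by `T` on `A`: almost every `x ∈ A` has a return
time `n`, the least positive integer with `T ^ n x ∈ A`, and `V x = T ^ n x`, while `V x = x` for
almost every `x ∉ A`. -/
def IsInduced {μ : Measure X} (T : MAut μ) (A : Set X) (V : MAut μ) : Prop :=
  ∀ᵐ x ∂μ,
    (x ∈ A → ∃ n : ℕ, IsLeast {k : ℕ | 0 < k ∧ T^[k] x ∈ A} n ∧ V x = T^[n] x) ∧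
    (x ∉ A → V x = x)

/-- A partial isomorphism of `(X, μ)`: a Borel bijection between two Borel subsets which
preserves the measures induced by `μ` on them. -/
structure PartialIso (μ : Measure X) where
  dom : Set X
  rng : Set X
  measurableSet_dom : MeasurableSet dom
  measurableSet_rng : MeasurableSet rng
  toEquiv : dom ≃ᵐ rng
  measurePreserving :
    MeasurePreserving toEquiv (μ.comap Subtype.val) (μ.comap Subtype.val)

/-- `φ.Graph x y`: `x` is in the domain of `φ` and `y = φ(x)`. -/
def PartialIso.Graph {μ : Measure X} (φ : PartialIso μ) (x y : X) : Prop :=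
  ∃ h : x ∈ φ.dom, (φ.toEquiv ⟨x, h⟩ : X) = y

/-- A graphing: a countable set of partial isomorphisms. -/
structure Graphing (μ : Measure X) where
  carrier : Set (PartialIso μ)
  countable : carrier.Countable

namespace Graphing

variable {μ : Measure X} (Φ : Graphing μ)

/-- The equivalence relation `R_Φ`: the smallest equivalence relation containing all
`(x, φ(x))`, for `φ ∈ Φ` and `x ∈ dom φ`. -/
def Rel : X → X → Prop :=
  Relation.EqvGen fun x y => ∃ φ ∈ Φ.carrier, φ.Graph x y

/-- `Φ` is aperiodic: almost all classes of `R_Φ` are infinite. -/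
def Aperiodic : Prop := ∀ᵐ x ∂μ, {y | Φ.Rel x y}.Infinite

/-- `y = φ(x)` for some `φ` in `Φ` or inverse of an element of `Φ`. -/
def Step (x y : X) : Prop := ∃ φ ∈ Φ.carrier, φ.Graph x y ∨ φ.Graph y x

/-- `y = φ_n ⋯ φ_1 (x)` for some `φ_1, …, φ_n` in `Φ ∪ Φ⁻¹`. -/
def Reach : ℕ → X → X → Prop
  | 0, x, y => x = y
  | n + 1, x, y => ∃ z, Reach n x z ∧ Φ.Step z y

/-- The distance `d_Φ(x, y)`: the least `n` such that `y = φ_n ⋯ φ_1 (x)` for some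
`φ_1, …, φ_n` in `Φ ∪ Φ⁻¹` (and `∞` when `x` and `y` are not in the same class). -/
noncomputable def d (x y : X) : ℝ≥0∞ := ⨅ (n : ℕ) (_ : Φ.Reach n x y), (n : ℝ≥0∞)

variable {Φ}

theorem Step.symm {x y : X} (h : Φ.Step x y) : Φ.Step y x := by
  obtain ⟨φ, hφ, h⟩ := h
  exact ⟨φ, hφ, h.symm⟩

theorem Reach.trans {m n : ℕ} {x y z : X} (h : Φ.Reach m x y) (h' : Φ.Reach n y z) :
    Φ.Reach (m + n) x z := by
  induction n generalizing z with
  | zero => cases h'; exact h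
  | succ n ih =>
    obtain ⟨w, hw, hs⟩ := h'
    exact ⟨w, ih hw, hs⟩

theorem Reach.symm {n : ℕ} {x y : X} (h : Φ.Reach n x y) : Φ.Reach n y x := by
  induction n generalizing y with
  | zero => exact Eq.symm h
  | succ n ih =>
    obtain ⟨w, hw, hs⟩ := h
    have h1 : Φ.Reach 1 y w := ⟨y, rfl, hs.symm⟩
    have := h1.trans (ih hw)
    rwa [add_comm] at this

theorem rel_iff_reach {x y : X} : Φ.Rel x y ↔ ∃ n, Φ.Reach n x y := by
  constructor
  · intro h
    induction h with
    | rel x y h =>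
      obtain ⟨φ, hφ, h⟩ := h
      exact ⟨1, x, rfl, φ, hφ, Or.inl h⟩
    | refl x => exact ⟨0, rfl⟩
    | symm x y _ ih => exact ih.imp fun n hn => hn.symm
    | trans x y z _ _ ih1 ih2 =>
      obtain ⟨m, hm⟩ := ih1
      obtain ⟨n, hn⟩ := ih2
      exact ⟨m + n, hm.trans hn⟩
  · rintro ⟨n, hn⟩
    induction n generalizing y with
    | zero => cases hn; exact Relation.EqvGen.refl _
    | succ n ih =>
      obtain ⟨z, hz, φ, hφ, h | h⟩ := hn
      · exact (ih hz).trans _ _ _ (Relation.EqvGen.rel _ _ ⟨φ, hφ, h⟩)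
      · exact (ih hz).trans _ _ _ ((Relation.EqvGen.rel _ _ ⟨φ, hφ, h⟩).symm)

theorem d_le {n : ℕ} {x y : X} (h : Φ.Reach n x y) : Φ.d x y ≤ n := iInf₂_le n h

theorem d_self (x : X) : Φ.d x x = 0 := by
  have : Φ.d x x ≤ (0 : ℕ) := d_le rfl
  simpa using this

theorem d_comm (x y : X) : Φ.d x y = Φ.d y x :=
  le_antisymm (le_iInf₂ fun _ h => d_le h.symm) (le_iInf₂ fun _ h => d_le h.symm)

theorem d_triangle (x y z : X) : Φ.d x z ≤ Φ.d x y + Φ.d y z := by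
  unfold d
  simp only [ENNReal.iInf_add, ENNReal.add_iInf]
  refine le_iInf fun m => le_iInf fun n => ?_
  refine le_iInf fun hm => le_iInf fun hn => ?_
  have := d_le (Reach.trans (by assumption) (by assumption) : Φ.Reach _ x z)
  unfold d at this
  refine this.trans ?_
  push_cast
  exact le_refl _

theorem eq_of_d_eq_zero {x y : X} (h : Φ.d x y = 0) : x = y := by
  by_contra hne
  have : (1 : ℝ≥0∞) ≤ Φ.d x y := by
    refine le_iInf₂ fun n hn => ?_
    rcases n with _ | n
    · exact absurd hn hne
    · exact_mod_cast Nat.succ_le_succ (Nat.zero_le n)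
  rw [h] at this
  simp at this

section Measurability

variable [StandardBorelSpace X]

theorem measurableSet_reach (n : ℕ) : MeasurableSet {p : X × X | Φ.Reach n p.1 p.2} := by
  induction n with
  | zero => exact measurableSet_diagonal
  | succ n ih =>
    have key : {p : X × X | Φ.Reach (n + 1) p.1 p.2} =
        ⋃ φ ∈ Φ.carrier,
          ((Subtype.val '' {q : {p : X × X | p.2 ∈ φ.rng} |
              Φ.Reach n q.1.1 (φ.toEquiv.symm ⟨q.1.2, q.2⟩)}) ∪
           (Subtype.val '' {q : {p : X × X | p.2 ∈ φ.dom} |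
              Φ.Reach n q.1.1 (φ.toEquiv ⟨q.1.2, q.2⟩)})) := by
      ext ⟨x, y⟩
      simp only [mem_ofPred_eq, mem_iUnion, mem_union, mem_image, Subtype.exists, Prod.exists,
        exists_prop]
      constructor
      · rintro ⟨z, hz, φ, hφ, ⟨h, e⟩ | ⟨h, e⟩⟩
        · refine ⟨φ, hφ, Or.inl ⟨x, y, ?_, ?_, rfl⟩⟩
          · rw [← e]; exact (φ.toEquiv ⟨z, h⟩).2
          · subst e
            show Φ.Reach n x (φ.toEquiv.symm (φ.toEquiv ⟨z, h⟩) : φ.dom)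
            rwa [φ.toEquiv.symm_apply_apply]
        · refine ⟨φ, hφ, Or.inr ⟨x, y, h, ?_, rfl⟩⟩
          show Φ.Reach n x (φ.toEquiv ⟨y, h⟩ : φ.rng)
          rwa [e]
      · rintro ⟨φ, hφ, ⟨x', y', h, hr, e⟩ | ⟨x', y', h, hr, e⟩⟩
        · obtain ⟨rfl, rfl⟩ := Prod.mk.inj e
          exact ⟨_, hr, φ, hφ, Or.inl ⟨(φ.toEquiv.symm ⟨y', h⟩).2, by simp⟩⟩
        · obtain ⟨rfl, rfl⟩ := Prod.mk.inj e
          exact ⟨_, hr, φ, hφ, Or.inr ⟨h, rfl⟩⟩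
    rw [key]
    refine MeasurableSet.biUnion Φ.countable fun φ _ => MeasurableSet.union ?_ ?_
    · refine MeasurableSet.subtype_image (measurable_snd φ.measurableSet_rng) ?_
      have hf : Measurable fun q : {p : X × X | p.2 ∈ φ.rng} =>
          ((q.1.1, ((φ.toEquiv.symm ⟨q.1.2, q.2⟩ : φ.dom) : X)) : X × X) :=
        (measurable_fst.comp measurable_subtype_coe).prodMk
          (measurable_subtype_coe.comp (φ.toEquiv.symm.measurable.comp
            ((measurable_snd.comp measurable_subtype_coe).subtype_mk)))
      exact hf ih
    · refine MeasurableSet.subtype_image (measurable_snd φ.measurableSet_dom) ?_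
      have hf : Measurable fun q : {p : X × X | p.2 ∈ φ.dom} =>
          ((q.1.1, ((φ.toEquiv ⟨q.1.2, q.2⟩ : φ.rng) : X)) : X × X) :=
        (measurable_fst.comp measurable_subtype_coe).prodMk
          (measurable_subtype_coe.comp (φ.toEquiv.measurable.comp
            ((measurable_snd.comp measurable_subtype_coe).subtype_mk)))
      exact hf ih

theorem measurable_d : Measurable fun p : X × X => Φ.d p.1 p.2 := by
  refine Measurable.iInf fun n => ?_
  classical
  have : (fun p : X × X => ⨅ _ : Φ.Reach n p.1 p.2, (n : ℝ≥0∞)) =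
      fun p => if p ∈ {p : X × X | Φ.Reach n p.1 p.2} then (n : ℝ≥0∞) else ⊤ := by
    funext p
    by_cases h : Φ.Reach n p.1 p.2 <;> simp [h]
  rw [this]
  exact Measurable.ite (measurableSet_reach n) measurable_const measurable_const

theorem measurable_d_comp {f g : X → X} (hf : Measurable f) (hg : Measurable g) :
    Measurable fun x => Φ.d (f x) (g x) := measurable_d.comp (hf.prodMk hg)

theorem measurable_d_id {g : X → X} (hg : Measurable g) :
    Measurable fun x => Φ.d x (g x) := measurable_d_comp measurable_id hg

end Measurability

variable (Φ)

/-- The full group `[R_Φ]`: the elements `T` of `Aut(X, μ)` with `T x R_Φ x` for almost all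
`x`. -/
def fullGroup : Subgroup (MAut μ) where
  carrier := {T | ∀ᵐ x ∂μ, Φ.Rel x (T x)}
  mul_mem' := by
    intro S T hS hT
    have hS' := T.mp.quasiMeasurePreserving.ae (show ∀ᵐ x ∂μ, Φ.Rel x (S x) from hS)
    filter_upwards [(show ∀ᵐ x ∂μ, Φ.Rel x (T x) from hT), hS', MAut.mul_ae S T] with x h1 h2 h3
    rw [h3]
    exact h1.trans _ _ _ h2
  one_mem' := by
    filter_upwards [MAut.one_ae (μ := μ)] with x hx
    rw [hx]
    exact Relation.EqvGen.refl _
  inv_mem' := by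
    intro T hT
    have hT' := T.mp_symm.quasiMeasurePreserving.ae (show ∀ᵐ x ∂μ, Φ.Rel x (T x) from hT)
    filter_upwards [hT', MAut.inv_ae T] with x h1 h2
    rw [h2]
    have h3 : T (T.perm.symm x) = x := Equiv.apply_symm_apply _ _
    rw [h3] at h1
    exact h1.symm

/-- The quantity `∫ d_Φ(S x, T x) dμ(x)`. -/
noncomputable def dL1 (S T : MAut μ) : ℝ≥0∞ := ∫⁻ x, Φ.d (S x) (T x) ∂μ

theorem dL1_comm (S T : MAut μ) : Φ.dL1 S T = Φ.dL1 T S :=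
  lintegral_congr fun _ => d_comm _ _

theorem dL1_one (T : MAut μ) : Φ.dL1 1 T = ∫⁻ x, Φ.d x (T x) ∂μ := by
  refine lintegral_congr_ae ?_
  filter_upwards [MAut.one_ae (μ := μ)] with x hx
  rw [hx]

variable [StandardBorelSpace X]

theorem dL1_triangle (S T U : MAut μ) : Φ.dL1 S U ≤ Φ.dL1 S T + Φ.dL1 T U := by
  unfold dL1
  rw [← lintegral_add_left (measurable_d_comp S.mp.measurable T.mp.measurable)]
  exact lintegral_mono fun _ => d_triangle _ _ _

/-- The `L¹` full group `[Φ]_1`: the elements `T` of `[R_Φ]` for which the (measurable) function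
`x ↦ d_Φ(x, T x)` has finite integral. -/
def l1FullGroup : Subgroup (MAut μ) where
  carrier := {T | T ∈ Φ.fullGroup ∧ ∫⁻ x, Φ.d x (T x) ∂μ < ∞}
  mul_mem' := by
    intro S T hS hT
    refine ⟨mul_mem hS.1 hT.1, ?_⟩
    have h1 : ∫⁻ x, Φ.d x ((S * T) x) ∂μ ≤
        ∫⁻ x, (Φ.d x (T x) + Φ.d (T x) (S (T x))) ∂μ := by
      refine lintegral_mono_ae ?_
      filter_upwards [MAut.mul_ae S T] with x hx
      rw [hx]
      exact d_triangle _ _ _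
    refine h1.trans_lt ?_
    rw [lintegral_add_left (measurable_d_id T.mp.measurable),
      T.mp.lintegral_comp (f := fun y => Φ.d y (S y))
        (measurable_d_id S.mp.measurable)]
    exact ENNReal.add_lt_top.2 ⟨hT.2, hS.2⟩
  one_mem' := by
    refine ⟨one_mem _, ?_⟩
    rw [← Φ.dL1_one]
    simp [dL1, d_self]
  inv_mem' := by
    intro T hT
    refine ⟨inv_mem hT.1, ?_⟩
    have h1 : ∫⁻ x, Φ.d x ((T⁻¹) x) ∂μ =
        ∫⁻ x, (fun y => Φ.d y (T y)) (T.perm.symm x) ∂μ := by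
      refine lintegral_congr_ae ?_
      filter_upwards [MAut.inv_ae T] with x hx
      rw [hx]
      have h3 : T (T.perm.symm x) = x := Equiv.apply_symm_apply _ _
      show _ = Φ.d (T.perm.symm x) (T (T.perm.symm x))
      rw [h3, d_comm]
    rw [h1, T.mp_symm.lintegral_comp (measurable_d_id T.mp.measurable)]
    exact hT.2

theorem dL1_ne_top (S T : Φ.l1FullGroup) : Φ.dL1 S.1 T.1 ≠ ∞ := by
  refine ((Φ.dL1_triangle S.1 1 T.1).trans_lt ?_).ne
  rw [Φ.dL1_comm S.1 1, dL1_one, dL1_one]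
  exact ENNReal.add_lt_top.2 ⟨S.2.2, T.2.2⟩

/-- The metric `(S, T) ↦ ∫ d_Φ(S x, T x) dμ(x)` on `[Φ]_1`, which defines its topology. -/
noncomputable instance : MetricSpace Φ.l1FullGroup where
  dist S T := (Φ.dL1 S.1 T.1).toReal
  dist_self S := by simp [dL1, d_self]
  dist_comm S T := by rw [Φ.dL1_comm]
  dist_triangle S T U := by
    rw [← ENNReal.toReal_add (Φ.dL1_ne_top S T) (Φ.dL1_ne_top T U)]
    exact ENNReal.toReal_mono (ENNReal.add_ne_top.2 ⟨Φ.dL1_ne_top S T, Φ.dL1_ne_top T U⟩)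
      (Φ.dL1_triangle _ _ _)
  eq_of_dist_eq_zero := by
    intro S T h
    have h1 : Φ.dL1 S.1 T.1 = 0 :=
      ((ENNReal.toReal_eq_zero_iff _).1 h).resolve_right (Φ.dL1_ne_top S T)
    have h2 := (lintegral_eq_zero_iff
      (measurable_d_comp S.1.mp.measurable T.1.mp.measurable)).1 h1
    refine Subtype.ext (MAut.ext_ae ?_)
    filter_upwards [h2] with x hx
    exact eq_of_d_eq_zero hx

end Graphing

end L1Full

/-! Write J for the subgroup generated by the involutions; it is normal, and the metric makes
`[Φ]_1` a topological group whose right translations are isometries.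

An involution U is joined to the identity by restricting it to an increasing family of U-invariant
sets whose boundaries are null, which is possible because μ has no atoms (`exists_path`). Right
translating such paths makes J path connected, so its closure is connected.

Commutators lie in the closure of J. Over a base A, the orbits of T are cut into columns; on a
column, the cyclic shift is a product of two reflections. Multiplying T by these reflections
(`exists_tower_mul`) kills it above the base and leaves the return map on the base. With a base that
almost selects one point per orbit where this makes sense, every S becomes, modulo J, of small
support E (`exists_small_support`). With base the complement of E, T becomes, modulo J, trivial on
most of E. Two such elements almost commute (`edist_mul_comm_le`), so their commutator is close to
J.

Involutions lie in the closure of the derived group. Choose one point in each 2-cycle of U to form a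
set A, and pair off the points of A greedily along countably many partial maps generating the
relation. What remains meets each class at most once, hence is null by aperiodicity. On each paired
piece, U restricts to the product of an involution and a conjugate of it, which is a commutator
(`res_union_image_mem_commutator`); finite products of these converge to U. -/

namespace L1Full

set_option linter.unusedSectionVars false

/-! ### Measure-preserving partial maps and gluing -/

section PresOn

variable {X : Type*} [MeasurableSpace X] {μ : Measure X}

/-- `f` is measurable, and injective and measure-preserving on the Borel set `D`. -/
structure PresOn (μ : Measure X) (f : X → X) (D : Set X) : Prop where
  measurable : Measurable f
  measurableSet : MeasurableSet D
  injOn : InjOn f D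
  measure_image : ∀ B ⊆ D, MeasurableSet B → μ (f '' B) = μ B

theorem PresOn.mono {f : X → X} {D E : Set X} (h : PresOn μ f D) (hE : MeasurableSet E)
    (hED : E ⊆ D) : PresOn μ f E :=
  ⟨h.measurable, hE, h.injOn.mono hED, fun B hB => h.measure_image B (hB.trans hED)⟩

theorem PresOn.of_mem {f : Equiv.Perm X} (hf : f ∈ mpPerm μ) {D : Set X} (hD : MeasurableSet D) :
    PresOn μ f D := by
  refine ⟨hf.1.measurable, hD, f.injective.injOn, fun B _ hB => ?_⟩
  rw [Equiv.image_eq_preimage_symm]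
  exact hf.2.measure_preimage hB.nullMeasurableSet

theorem PresOn.id {D : Set X} (hD : MeasurableSet D) : PresOn μ (fun x => x) D :=
  ⟨measurable_id, hD, fun _ _ _ _ h => h, fun B _ _ => by simp⟩

variable [StandardBorelSpace X]

theorem PresOn.comp {f g : X → X} {D E : Set X} (hg : PresOn μ g E) (hf : PresOn μ f D) :
    PresOn μ (g ∘ f) (D ∩ f ⁻¹' E) := by
  refine ⟨hg.measurable.comp hf.measurable, hf.measurableSet.inter (hf.measurable hg.measurableSet),
    fun x hx y hy h => hf.injOn hx.1 hy.1 (hg.injOn hx.2 hy.2 h), fun B hB hBm => ?_⟩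
  have hBD : B ⊆ D := fun x hx => (hB hx).1
  rw [image_comp, hg.measure_image, hf.measure_image B hBD hBm]
  · rintro _ ⟨x, hx, rfl⟩
    exact (hB hx).2
  · exact hBm.image_of_measurable_injOn hf.measurable (hf.injOn.mono hBD)

/-- A bijection that is piecewise measure-preserving on countably many Borel pieces preserves μ. The
pieces may overlap: the push-forward under the inverse is compared with μ on each piece separately.
-/
theorem mem_mpPerm_of_cover {ι : Type*} [Countable ι] (e : Equiv.Perm X) {f : ι → X → X}
    {D : ι → Set X} (h : ∀ i, PresOn μ (f i) (D i)) (he : ∀ i, ∀ x ∈ D i, e x = f i x)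
    (hc : ∀ x, ∃ i, x ∈ D i) : e ∈ mpPerm μ := by
  have hm : Measurable e := by
    intro B hB
    have : e ⁻¹' B = ⋃ i, D i ∩ f i ⁻¹' B := by
      ext x
      simp only [mem_preimage, mem_iUnion, mem_inter_iff]
      constructor
      · intro hx
        obtain ⟨i, hi⟩ := hc x
        exact ⟨i, hi, he i x hi ▸ hx⟩
      · rintro ⟨i, hi, hx⟩
        rwa [he i x hi]
    rw [this]
    exact MeasurableSet.iUnion fun i => (h i).measurableSet.inter ((h i).measurable hB)
  have hms : Measurable e.symm := by
    intro B hB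
    rw [← Equiv.image_eq_preimage_symm]
    exact hB.image_of_measurable_injOn hm e.injective.injOn
  have hmap : μ.map e.symm = μ := by
    have hU : ⋃ i, D i = univ := by
      ext x
      simpa using hc x
    refine (Measure.ext_iff_of_iUnion_eq_univ hU).2 fun i => Measure.ext fun B hB => ?_
    have hBi := hB.inter (h i).measurableSet
    rw [Measure.restrict_apply hB, Measure.restrict_apply hB, Measure.map_apply hms hBi,
      ← Equiv.image_eq_preimage_symm, ← (h i).measure_image _ inter_subset_right hBi]
    congr 1
    exact image_congr fun x hx => he i x hx.2
  have h2 : MeasurePreserving e.symm μ μ := ⟨hms, hmap⟩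
  exact ⟨MeasurePreserving.symm (e := ⟨e.symm, hms, hm⟩) h2, h2⟩

end PresOn

/-! ### Lifts to genuine bijections, and the topological group structure -/

section L1

variable {X : Type*} [MeasurableSpace X] [StandardBorelSpace X] {μ : Measure X} (Φ : Graphing μ)

/-- The measure-preserving bijections whose class belongs to `[Φ]_1`. -/
def Graphing.l1 : Subgroup (mpPerm μ) := Φ.l1FullGroup.comap (QuotientGroup.mk' (aeId μ))

/-- The quotient map onto `[Φ]_1`. -/
def Graphing.toL1 : Φ.l1 →* Φ.l1FullGroup := (QuotientGroup.mk' (aeId μ)).subgroupComap _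

variable {Φ}

theorem Graphing.rel_of_d_ne_top {x y : X} (h : Φ.d x y ≠ ∞) : Φ.Rel x y := by
  rw [rel_iff_reach]
  by_contra hn
  push Not at hn
  exact h (by simp [Graphing.d, hn])

theorem Graphing.mem_l1FullGroup_iff {T : MAut μ} :
    T ∈ Φ.l1FullGroup ↔ ∫⁻ x, Φ.d x (T x) ∂μ ≠ ∞ := by
  refine ⟨fun h => h.2.ne, fun h => ⟨?_, lt_top_iff_ne_top.2 h⟩⟩
  filter_upwards [ae_lt_top (measurable_d_id T.mp.measurable) h] with x hx
  exact rel_of_d_ne_top hx.ne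

theorem Graphing.mem_l1_iff {f : mpPerm μ} : f ∈ Φ.l1 ↔ ∫⁻ x, Φ.d x (f.1 x) ∂μ ≠ ∞ := by
  have : ∫⁻ x, Φ.d x (f.1 x) ∂μ = ∫⁻ x, Φ.d x ((QuotientGroup.mk f : MAut μ) x) ∂μ := by
    refine lintegral_congr_ae ?_
    filter_upwards [MAut.mk_ae f] with x hx
    rw [hx]
  rw [this]
  exact mem_l1FullGroup_iff

theorem Graphing.toL1_ae (f : Φ.l1) : ∀ᵐ x ∂μ, (Φ.toL1 f : MAut μ) x = f.1.1 x := MAut.mk_ae f.1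

theorem Graphing.edist_l1 (S T : Φ.l1FullGroup) : edist S T = Φ.dL1 S.1 T.1 := by
  rw [edist_dist]
  exact ENNReal.ofReal_toReal (Φ.dL1_ne_top S T)

theorem Graphing.edist_toL1 (f g : Φ.l1) :
    edist (Φ.toL1 f) (Φ.toL1 g) = ∫⁻ x, Φ.d (f.1.1 x) (g.1.1 x) ∂μ := by
  rw [edist_l1]
  refine lintegral_congr_ae ?_
  filter_upwards [toL1_ae f, toL1_ae g] with x h1 h2
  rw [h1, h2]

theorem Graphing.toL1_surjective : Function.Surjective Φ.toL1 := by
  rintro ⟨T, hT⟩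
  obtain ⟨f, rfl⟩ := QuotientGroup.mk_surjective T
  exact ⟨⟨f, hT⟩, rfl⟩

theorem Graphing.toL1_eq {f g : Φ.l1} (h : ∀ᵐ x ∂μ, f.1.1 x = g.1.1 x) : Φ.toL1 f = Φ.toL1 g := by
  refine Subtype.ext (MAut.ext_ae ?_)
  filter_upwards [toL1_ae f, toL1_ae g, h] with x h1 h2 h3
  rw [h1, h2, h3]

theorem Graphing.ae_eq_of_toL1_eq {f g : Φ.l1} (h : Φ.toL1 f = Φ.toL1 g) :
    ∀ᵐ x ∂μ, f.1.1 x = g.1.1 x := by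
  filter_upwards [toL1_ae f, toL1_ae g] with x h1 h2
  rw [← h1, ← h2, h]

theorem lintegral_comp_mp {f : mpPerm μ} {F : X → ℝ≥0∞} (hF : Measurable F) :
    ∫⁻ x, F (f.1 x) ∂μ = ∫⁻ x, F x ∂μ := f.2.1.lintegral_comp hF

theorem measurable_val (f : mpPerm μ) : Measurable f.1 := f.2.1.measurable

theorem setLIntegral_comp_mp {f : mpPerm μ} {F : X → ℝ≥0∞} (hF : Measurable F) {E : Set X}
    (hE : MeasurableSet E) :
    ∫⁻ x in f.1 ⁻¹' E, F (f.1 x) ∂μ = ∫⁻ x in E, F x ∂μ :=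
  f.2.1.setLIntegral_comp_preimage hE hF

theorem measure_preimage_mp (f : mpPerm μ) {E : Set X} (hE : MeasurableSet E) :
    μ (f.1 ⁻¹' E) = μ E := f.2.1.measure_preimage hE.nullMeasurableSet

theorem Graphing.measurable_d_perm (f : mpPerm μ) : Measurable fun x => Φ.d x (f.1 x) :=
  measurable_d_id (measurable_val f)

/-- Change of variables along h. Left multiplication is not isometric, since s may stretch
distances. -/
theorem Graphing.edist_mul_right (f g h : Φ.l1FullGroup) : edist (f * h) (g * h) = edist f g := by
  obtain ⟨f, rfl⟩ := toL1_surjective f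
  obtain ⟨g, rfl⟩ := toL1_surjective g
  obtain ⟨h, rfl⟩ := toL1_surjective h
  rw [← map_mul, ← map_mul, edist_toL1, edist_toL1]
  exact lintegral_comp_mp (f := h.1) (F := fun x => Φ.d (f.1.1 x) (g.1.1 x))
    (measurable_d_comp (measurable_val f.1) (measurable_val g.1))

theorem Graphing.one_le_d {x y : X} (h : x ≠ y) : 1 ≤ Φ.d x y := by
  refine le_iInf₂ fun n hn => ?_
  rcases n with _ | n
  · exact absurd hn h
  · exact_mod_cast Nat.succ_le_succ (Nat.zero_le n)

theorem measurableSet_ne_mp (f g : mpPerm μ) : MeasurableSet {x | f.1 x ≠ g.1 x} :=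
  (measurableSet_eq_fun (measurable_val f) (measurable_val g)).compl

theorem Graphing.measure_ne_le (f g : Φ.l1) :
    μ {x | f.1.1 x ≠ g.1.1 x} ≤ edist (Φ.toL1 f) (Φ.toL1 g) := by
  rw [edist_toL1, ← lintegral_indicator_one (measurableSet_ne_mp f.1 g.1)]
  refine lintegral_mono fun x => ?_
  by_cases h : f.1.1 x = g.1.1 x
  · simp [h]
  · simpa [indicator, h] using one_le_d h

/-- The maps s r and s t differ only on N, the set where r and t differ. As distinct points are at
distance at least 1, the measure of N is at most the distance from r to t. Going through r x and t x
costs the displacement of s over r N and t N, which is small by absolute continuity of its integral.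
-/
theorem Graphing.continuous_mul_left_l1 (S : Φ.l1FullGroup) :
    Continuous fun T : Φ.l1FullGroup => S * T := by
  rw [EMetric.continuous_iff]
  intro T ε hε
  obtain ⟨s, rfl⟩ := toL1_surjective S
  obtain ⟨t, rfl⟩ := toL1_surjective T
  have hs : ∫⁻ x, Φ.d x (s.1.1 x) ∂μ ≠ ∞ := mem_l1_iff.1 s.2
  have h3 : ε / 3 ≠ 0 := by simpa using hε.ne'
  obtain ⟨δ, hδ, hsδ⟩ := exists_pos_setLIntegral_lt_of_measure_lt hs h3
  refine ⟨min δ (ε / 3), lt_min hδ (pos_iff_ne_zero.2 h3), fun R hR => ?_⟩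
  obtain ⟨r, rfl⟩ := toL1_surjective R
  rw [← map_mul, ← map_mul, edist_toL1]
  set N : Set X := {x | r.1.1 x ≠ t.1.1 x}
  have hN : MeasurableSet N := measurableSet_ne_mp r.1 t.1
  have hNμ : μ N < δ := (measure_ne_le r t).trans_lt (hR.trans_le (min_le_left _ _))
  have key : ∀ f : Φ.l1, ∫⁻ x in N, Φ.d (f.1.1 x) (s.1.1 (f.1.1 x)) ∂μ < ε / 3 := by
    intro f
    have hE : MeasurableSet (f.1.1.symm ⁻¹' N) := f.1.2.2.measurable hN
    have := setLIntegral_comp_mp (f := f.1) (measurable_d_perm (Φ := Φ) s.1) hE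
    rw [← preimage_comp, Equiv.symm_comp_self, preimage_id] at this
    rw [this]
    refine hsδ _ ?_
    rwa [f.1.2.2.measure_preimage hN.nullMeasurableSet]
  have hm := measurable_d_perm (Φ := Φ) s.1
  calc ∫⁻ x, Φ.d (s.1.1 (r.1.1 x)) (s.1.1 (t.1.1 x)) ∂μ
      ≤ ∫⁻ x, (N.indicator (fun x => Φ.d (r.1.1 x) (s.1.1 (r.1.1 x))) x
          + (Φ.d (r.1.1 x) (t.1.1 x)
          + N.indicator (fun x => Φ.d (t.1.1 x) (s.1.1 (t.1.1 x))) x)) ∂μ := by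
        refine lintegral_mono fun x => ?_
        by_cases hx : r.1.1 x = t.1.1 x
        · have : x ∉ N := fun h => h hx
          simp [hx, d_self]
        · have hx' : x ∈ N := hx
          simp only [indicator_of_mem hx']
          refine (d_triangle _ (r.1.1 x) _).trans ?_
          rw [d_comm (s.1.1 _) (r.1.1 x)]
          gcongr
          exact d_triangle _ _ _
    _ = ∫⁻ x in N, Φ.d (r.1.1 x) (s.1.1 (r.1.1 x)) ∂μ + (edist (Φ.toL1 r) (Φ.toL1 t)
          + ∫⁻ x in N, Φ.d (t.1.1 x) (s.1.1 (t.1.1 x)) ∂μ) := by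
        have m1 : Measurable (N.indicator (fun x => Φ.d (r.1.1 x) (s.1.1 (r.1.1 x)))) :=
          (hm.comp (measurable_val r.1)).indicator hN
        have m2 : Measurable fun x => Φ.d (r.1.1 x) (t.1.1 x) :=
          measurable_d_comp (measurable_val r.1) (measurable_val t.1)
        rw [lintegral_add_left m1, lintegral_add_left m2, lintegral_indicator hN,
          lintegral_indicator hN, edist_toL1]
    _ < ε / 3 + (ε / 3 + ε / 3) :=
        ENNReal.add_lt_add (key r) (ENNReal.add_lt_add (hR.trans_le (min_le_right _ _)) (key t))
    _ = ε := by rw [← add_assoc, ENNReal.add_thirds]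

instance Graphing.isTopologicalGroup_l1 : IsTopologicalGroup Φ.l1FullGroup where
  continuous_mul := by
    rw [continuous_iff_continuousAt]
    rintro ⟨S, T⟩
    rw [ContinuousAt, tendsto_iff_edist_tendsto_0]
    have h1 : Filter.Tendsto (fun p : Φ.l1FullGroup × Φ.l1FullGroup =>
        edist p.1 S + edist (S * p.2) (S * T)) (nhds (S, T)) (nhds 0) := by
      have hc : Continuous fun p : Φ.l1FullGroup × Φ.l1FullGroup =>
          edist p.1 S + edist (S * p.2) (S * T) :=
        (continuous_fst.edist continuous_const).add
          (((continuous_mul_left_l1 S).comp continuous_snd).edist continuous_const)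
      simpa using hc.tendsto (S, T)
    refine tendsto_of_tendsto_of_tendsto_of_le_of_le tendsto_const_nhds h1 (fun _ => bot_le)
      fun p => ?_
    refine (edist_triangle (p.1 * p.2) (S * p.2) (S * T)).trans ?_
    rw [edist_mul_right]
  continuous_inv := by
    rw [continuous_iff_continuousAt]
    intro S
    rw [ContinuousAt, tendsto_iff_edist_tendsto_0]
    have h : ∀ T : Φ.l1FullGroup, edist T⁻¹ S⁻¹ = edist (S⁻¹ * S) (S⁻¹ * T) := by
      intro T
      rw [← edist_mul_right T⁻¹ S⁻¹ T, inv_mul_cancel, inv_mul_cancel]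
    simp only [h]
    have hc : Continuous fun T : Φ.l1FullGroup => edist (S⁻¹ * S) (S⁻¹ * T) :=
      continuous_const.edist (continuous_mul_left_l1 S⁻¹)
    simpa using hc.tendsto S

end L1

/-! ### Restricting involutions, and paths to the identity -/

section Involutions

open Filter Topology

variable {X : Type*} [MeasurableSpace X] [StandardBorelSpace X] {μ : Measure X} {Φ : Graphing μ}

theorem mem_mpPerm_of_piecewise (e : Equiv.Perm X) {f g : Equiv.Perm X} (hf : f ∈ mpPerm μ)
    (hg : g ∈ mpPerm μ) {E : Set X} (hE : MeasurableSet E) (h1 : ∀ x ∈ E, e x = f x)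
    (h2 : ∀ x ∉ E, e x = g x) : e ∈ mpPerm μ := by
  refine mem_mpPerm_of_cover (ι := Bool) e (f := fun b => if b then f else g)
    (D := fun b => if b then E else Eᶜ) ?_ ?_ ?_
  · rintro (_ | _)
    · exact PresOn.of_mem hg hE.compl
    · exact PresOn.of_mem hf hE
  · rintro (_ | _) x hx
    · exact h2 x hx
    · exact h1 x hx
  · intro x
    by_cases hx : x ∈ E
    · exact ⟨true, hx⟩
    · exact ⟨false, hx⟩

theorem Graphing.mem_l1_of_eq_or_eq {f e : mpPerm μ} (hf : f ∈ Φ.l1)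
    (h : ∀ x, e.1 x = f.1 x ∨ e.1 x = x) : e ∈ Φ.l1 := by
  rw [mem_l1_iff] at hf ⊢
  refine ne_top_of_le_ne_top hf (lintegral_mono fun x => ?_)
  rcases h x with h | h <;> rw [h]
  simp [d_self]

theorem Graphing.tendsto_toL1 {ι : Type*} {l : Filter ι} [l.IsCountablyGenerated] {F : ι → Φ.l1}
    {f : Φ.l1} {b : X → ℝ≥0∞} (hb : ∫⁻ x, b x ∂μ ≠ ∞)
    (hF : ∀ i x, Φ.d ((F i).1.1 x) (f.1.1 x) ≤ b x)
    (h : ∀ᵐ x ∂μ, ∀ᶠ i in l, (F i).1.1 x = f.1.1 x) :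
    Tendsto (fun i => Φ.toL1 (F i)) l (𝓝 (Φ.toL1 f)) := by
  rw [tendsto_iff_edist_tendsto_0]
  simp only [edist_toL1]
  have := tendsto_lintegral_filter_of_dominated_convergence (μ := μ) (l := l)
    (F := fun i x => Φ.d ((F i).1.1 x) (f.1.1 x)) (f := fun _ => 0) b
    (Eventually.of_forall fun i =>
      measurable_d_comp (measurable_val (F i).1) (measurable_val f.1))
    (Eventually.of_forall fun i => Eventually.of_forall (hF i)) hb (by
      filter_upwards [h] with x hx
      refine tendsto_const_nhds.congr' ?_
      filter_upwards [hx] with i hi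
      rw [hi, d_self])
  simpa using this

open Classical in
/-- An involution `u`, restricted to the `u`-saturation of `E`. -/
noncomputable def resPerm (u : Equiv.Perm X) (hu : ∀ x, u (u x) = x) (E : Set X) :
    Equiv.Perm X :=
  Function.Involutive.toPerm (fun x => if x ∈ E ∨ u x ∈ E then u x else x) <| by
    intro x
    by_cases h : x ∈ E ∨ u x ∈ E
    · have h' : u x ∈ E ∨ x ∈ E := h.symm
      simp [h, h', hu]
    · simp [h]

theorem resPerm_apply_of_mem {u : Equiv.Perm X} (hu : ∀ x, u (u x) = x) {E : Set X} {x : X}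
    (h : x ∈ E ∨ u x ∈ E) : resPerm u hu E x = u x :=
  if_pos h

theorem resPerm_apply_of_notMem {u : Equiv.Perm X} (hu : ∀ x, u (u x) = x) {E : Set X} {x : X}
    (h : ¬ (x ∈ E ∨ u x ∈ E)) : resPerm u hu E x = x :=
  if_neg h

theorem resPerm_resPerm {u : Equiv.Perm X} (hu : ∀ x, u (u x) = x) (E : Set X) (x : X) :
    resPerm u hu E (resPerm u hu E x) = x :=
  Function.Involutive.toPerm_involutive _ x

theorem resPerm_mem {u : Equiv.Perm X} (hu : ∀ x, u (u x) = x) (h : u ∈ mpPerm μ) {E : Set X}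
    (hE : MeasurableSet E) : resPerm u hu E ∈ mpPerm μ :=
  mem_mpPerm_of_piecewise _ h (one_mem _) (hE.union (h.1.measurable hE))
    (fun _ hx => resPerm_apply_of_mem hu hx) (fun _ hx => resPerm_apply_of_notMem hu hx)

/-- An involution of `[Φ]_1`, restricted to the saturation of a Borel set. -/
noncomputable def Graphing.res (u : Φ.l1) (hu : ∀ x, u.1.1 (u.1.1 x) = x) (E : Set X)
    (hE : MeasurableSet E) : Φ.l1 :=
  ⟨⟨resPerm u.1.1 hu E, resPerm_mem hu u.1.2 hE⟩, mem_l1_of_eq_or_eq u.2 fun x => by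
    by_cases h : x ∈ E ∨ u.1.1 x ∈ E
    · exact Or.inl (resPerm_apply_of_mem hu h)
    · exact Or.inr (resPerm_apply_of_notMem hu h)⟩

theorem Graphing.toL1_mul_self {u : Φ.l1} (hu : ∀ x, u.1.1 (u.1.1 x) = x) :
    Φ.toL1 u * Φ.toL1 u = 1 := by
  rw [← map_mul, ← map_one Φ.toL1]
  exact toL1_eq (Eventually.of_forall hu)

/-- A lift squares to the identity only almost everywhere; replacing it by the identity elsewhere
gives an involution at every point, so that no null set has to be carried along. -/
theorem Graphing.exists_involutive_lift {U : Φ.l1FullGroup} (hU : U * U = 1) :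
    ∃ u : Φ.l1, (∀ x, u.1.1 (u.1.1 x) = x) ∧ Φ.toL1 u = U := by
  classical
  obtain ⟨f, rfl⟩ := toL1_surjective U
  have hae : ∀ᵐ x ∂μ, f.1.1 (f.1.1 x) = x := by
    rw [← map_mul, ← map_one Φ.toL1] at hU
    exact ae_eq_of_toL1_eq hU
  set p : Equiv.Perm X := f.1.1
  have hv : Function.Involutive fun x => if p (p x) = x then p x else x := by
    intro x
    by_cases h : p (p x) = x
    · simp [h]
    · simp [h]
  have hE : MeasurableSet {x | p (p x) = x} :=
    measurableSet_eq_fun ((measurable_val f.1).comp (measurable_val f.1)) measurable_id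
  have hmem : hv.toPerm ∈ mpPerm μ := by
    refine mem_mpPerm_of_piecewise _ f.1.2 (one_mem _) hE (fun x hx => ?_) (fun x hx => ?_)
    · exact if_pos hx
    · exact if_neg hx
  refine ⟨⟨⟨hv.toPerm, hmem⟩, mem_l1_of_eq_or_eq f.2 fun x => ?_⟩, hv, toL1_eq ?_⟩
  · by_cases h : p (p x) = x
    · exact Or.inl (if_pos h)
    · exact Or.inr (if_neg h)
  · filter_upwards [hae] with x hx
    exact if_pos hx

theorem Graphing.d_res_le (u : Φ.l1) (hu : ∀ x, u.1.1 (u.1.1 x) = x) {E F : Set X}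
    (hE : MeasurableSet E) (hF : MeasurableSet F) (x : X) :
    Φ.d ((res u hu E hE).1.1 x) ((res u hu F hF).1.1 x) ≤ Φ.d x (u.1.1 x) := by
  have h : ∀ G (hG : MeasurableSet G),
      (res u hu G hG).1.1 x = u.1.1 x ∨ (res u hu G hG).1.1 x = x := by
    intro G hG
    by_cases h : x ∈ G ∨ u.1.1 x ∈ G
    · exact Or.inl (resPerm_apply_of_mem hu h)
    · exact Or.inr (resPerm_apply_of_notMem hu h)
  rcases h E hE with h1 | h1 <;> rcases h F hF with h2 | h2 <;> rw [h1, h2]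
  · simp [d_self]
  · rw [d_comm]
  · simp [d_self]

variable (X) in
/-- An injective Borel map to the open unit interval. -/
theorem exists_injective_measurable_real :
    ∃ g : X → ℝ, Measurable g ∧ Function.Injective g ∧ ∀ x, 0 < g x ∧ g x < 1 := by
  have h := measurableEmbedding_embeddingReal X
  refine ⟨fun x => Real.sigmoid (embeddingReal X x), ?_, ?_, fun x =>
    ⟨Real.sigmoid_pos _, Real.sigmoid_lt_one _⟩⟩
  · exact Real.sigmoid_strictMono.monotone.measurable.comp h.measurable
  · exact Real.sigmoid_injective.comp h.injective

/-- The function f = min (g, g ∘ u) is u-invariant with values in (0, 1), and its level sets are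
null because g is injective and μ has no atoms. The restrictions of u to {f ≤ t} go from the
identity to u. For fixed t, almost every x has f x ≠ t, so its image is constant for parameters near
t, and dominated convergence gives continuity. -/
theorem Graphing.exists_path [NullSingletonClass μ] {U : Φ.l1FullGroup} (hU : U * U = 1) :
    ∃ γ : Path (1 : Φ.l1FullGroup) U, ∀ t : unitInterval,
      γ t * γ t = 1 ∧
      ∃ A : Set X, MeasurableSet A ∧ IsInduced (U : MAut μ) A (γ t) := by
  obtain ⟨u, hu, rfl⟩ := exists_involutive_lift hU
  obtain ⟨g, hg, hgi, hg01⟩ := exists_injective_measurable_real X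
  set f : X → ℝ := fun x => min (g x) (g (u.1.1 x)) with hf
  have hfm : Measurable f := hg.min (hg.comp (measurable_val u.1))
  have hfu : ∀ x, f (u.1.1 x) = f x := fun x => by simp only [hf, hu, min_comm]
  have hA : ∀ t : ℝ, MeasurableSet {x | f x ≤ t} := fun t => measurableSet_le hfm measurable_const
  have hr1 : ∀ (t : ℝ) x, f x ≤ t → (res u hu _ (hA t)).1.1 x = u.1.1 x := fun t x hx =>
    resPerm_apply_of_mem hu (Or.inl hx)
  have hr2 : ∀ (t : ℝ) x, ¬ f x ≤ t → (res u hu _ (hA t)).1.1 x = x := fun t x hx =>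
    resPerm_apply_of_notMem hu (by simpa [hfu] using hx)
  have hnull : ∀ c : ℝ, ∀ᵐ x ∂μ, g x ≠ c := by
    intro c
    have : μ {x | g x = c} = 0 :=
      Set.Subsingleton.measure_zero (fun x hx y hy => hgi (hx.trans hy.symm)) μ
    exact measure_eq_zero_iff_ae_notMem.1 this
  have hfnull : ∀ c : ℝ, ∀ᵐ x ∂μ, f x ≠ c := by
    intro c
    filter_upwards [hnull c, u.1.2.1.quasiMeasurePreserving.ae (hnull c)] with x h1 h2
    rcases min_choice (g x) (g (u.1.1 x)) with h | h
    · simpa only [hf, h] using h1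
    · simpa only [hf, h] using h2
  have hcont : Continuous fun t : unitInterval => Φ.toL1 (res u hu _ (hA t)) := by
    rw [continuous_iff_continuousAt]
    intro t
    refine tendsto_toL1 (b := fun x => Φ.d x (u.1.1 x)) (mem_l1_iff.1 u.2)
      (fun s x => d_res_le u hu _ _ x) ?_
    filter_upwards [hfnull t] with x hx
    rcases lt_or_gt_of_ne hx with h | h
    · have : ∀ᶠ s : unitInterval in 𝓝 t, f x < s :=
        (continuous_subtype_val.tendsto t).eventually_const_lt h
      filter_upwards [this] with s hs
      rw [hr1 _ _ hs.le, hr1 _ _ h.le]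
    · have : ∀ᶠ s : unitInterval in 𝓝 t, s < f x :=
        (continuous_subtype_val.tendsto t).eventually_lt_const h
      filter_upwards [this] with s hs
      rw [hr2 _ _ (not_le.2 hs), hr2 _ _ (not_le.2 h)]
  refine ⟨⟨⟨_, hcont⟩, ?_, ?_⟩, fun t => ⟨?_, {x | f x ≤ t}, hA t, ?_⟩⟩
  · rw [← map_one Φ.toL1]
    refine toL1_eq (Eventually.of_forall fun x => hr2 _ _ ?_)
    simpa [hf] using ⟨(hg01 x).1, (hg01 _).1⟩
  · refine toL1_eq (Eventually.of_forall fun x => hr1 _ _ ?_)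
    simpa [hf] using Or.inl (hg01 x).2.le
  · exact toL1_mul_self (resPerm_resPerm hu _)
  · filter_upwards [toL1_ae u, toL1_ae (res u hu _ (hA t))] with x h1 h2
    -- The set {f ≤ t} is u-invariant, so the return time is 1.
    refine ⟨fun hx => ⟨1, ⟨⟨one_pos, ?_⟩, fun k hk => hk.1⟩, ?_⟩, fun hx => ?_⟩
    · rw [Function.iterate_one, h1, hfu]
      exact hx
    · rw [Function.iterate_one, h1]
      exact h2.trans (hr1 _ _ hx)
    · exact h2.trans (hr2 _ _ hx)

variable (Φ) in
/-- The subgroup of `[Φ]_1` generated by involutions. -/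
def Graphing.involutionSubgroup : Subgroup Φ.l1FullGroup := Subgroup.closure {U | U * U = 1}

theorem Graphing.isPathConnected_involutionSubgroup [NullSingletonClass μ] :
    IsPathConnected (Φ.involutionSubgroup : Set Φ.l1FullGroup) := by
  set J := Φ.involutionSubgroup
  have htrans : ∀ {a b c : Φ.l1FullGroup}, c ∈ J → JoinedIn (J : Set Φ.l1FullGroup) a b →
      JoinedIn (J : Set Φ.l1FullGroup) (a * c) (b * c) := by
    rintro a b c hc ⟨γ, hγ⟩
    exact ⟨γ.map (continuous_mul_const c), fun t => mul_mem (hγ t) hc⟩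
  refine ⟨1, one_mem J, fun {y} hy => ?_⟩
  induction hy using Subgroup.closure_induction with
  | mem U hU =>
    obtain ⟨γ, hγ⟩ := exists_path hU
    exact ⟨γ, fun t => Subgroup.subset_closure (hγ t).1⟩
  | one => exact JoinedIn.refl (one_mem J)
  | mul a b _ hb iha ihb =>
    have := htrans hb iha
    rw [one_mul] at this
    exact ihb.trans this
  | inv a ha iha =>
    have := htrans (inv_mem ha) iha
    rw [one_mul, mul_inv_cancel] at this
    exact this.symm

end Involutions

/-! ### Columns over a base, and reduction to small support modulo involutions -/

section Towers

open Filter Topology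

/-- The points `x` such that `T⁻ⁱ x` and `Tʲ⁺¹ x` are in `A`, while the points between them on
the orbit are not. -/
def tower {X : Type*} (T : Equiv.Perm X) (A : Set X) (i j : ℕ) : Set X :=
  {x | (T ^ (-(i : ℤ))) x ∈ A ∧ (T ^ ((j : ℤ) + 1)) x ∈ A ∧
    ∀ k : ℤ, -(i : ℤ) < k → k ≤ j → (T ^ k) x ∉ A}

theorem tower_unique {X : Type*} {T : Equiv.Perm X} {A : Set X} {i j i' j' : ℕ} {x : X}
    (h : x ∈ tower T A i j) (h' : x ∈ tower T A i' j') : i = i' ∧ j = j' := by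
  obtain ⟨h1, h2, h3⟩ := h
  obtain ⟨h1', h2', h3'⟩ := h'
  constructor
  · rcases lt_trichotomy i i' with hlt | heq | hlt
    · exact absurd h1 (h3' _ (by omega) (by omega))
    · exact heq
    · exact absurd h1' (h3 _ (by omega) (by omega))
  · rcases lt_trichotomy j j' with hlt | heq | hlt
    · exact absurd h2 (h3' _ (by omega) (by omega))
    · exact heq
    · exact absurd h2' (h3 _ (by omega) (by omega))

theorem tower_shift {X : Type*} {T : Equiv.Perm X} {A : Set X} {i j i' j' : ℕ} {x : X}
    (h : x ∈ tower T A i j) (hij : i' + j' = i + j) :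
    (T ^ ((i' : ℤ) - i)) x ∈ tower T A i' j' := by
  obtain ⟨h1, h2, h3⟩ := h
  have e : ∀ k : ℤ, (T ^ k) ((T ^ ((i' : ℤ) - i)) x) = (T ^ (k + ((i' : ℤ) - i))) x := fun k => by
    rw [zpow_add, Equiv.Perm.mul_apply]
  refine ⟨?_, ?_, fun k hk1 hk2 => ?_⟩
  · rw [e]
    convert h1 using 3
    ring
  · rw [e]
    convert h2 using 3
    omega
  · rw [e]
    exact h3 _ (by omega) (by omega)

theorem exists_mem_tower {X : Type*} {T : Equiv.Perm X} {A : Set X} {x : X}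
    (h1 : ∃ i : ℕ, (T ^ (-(i : ℤ))) x ∈ A) (h2 : ∃ j : ℕ, (T ^ ((j : ℤ) + 1)) x ∈ A) :
    ∃ i j, x ∈ tower T A i j := by
  classical
  refine ⟨Nat.find h1, Nat.find h2, Nat.find_spec h1, Nat.find_spec h2, fun k hk1 hk2 hk => ?_⟩
  rcases le_or_gt k 0 with h0 | h0
  · refine Nat.find_min h1 (m := k.natAbs) (by omega) ?_
    convert hk using 3
    omega
  · refine Nat.find_min h2 (m := k.natAbs - 1) (by omega) ?_
    convert hk using 3
    omega

variable {X : Type*} [MeasurableSpace X] [StandardBorelSpace X] {μ : Measure X} {Φ : Graphing μ}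

theorem measurable_zpow (T : mpPerm μ) (k : ℤ) : Measurable (T.1 ^ k) := measurable_val (T ^ k)

theorem measurableSet_zpow_mem (T : mpPerm μ) (k : ℤ) {A : Set X} (hA : MeasurableSet A) :
    MeasurableSet {x | (T.1 ^ k) x ∈ A} := measurable_zpow T k hA

theorem measurableSet_tower (T : mpPerm μ) {A : Set X} (hA : MeasurableSet A) (i j : ℕ) :
    MeasurableSet (tower T.1 A i j) := by
  refine (measurableSet_zpow_mem T _ hA).inter ((measurableSet_zpow_mem T _ hA).inter ?_)
  have : {x | ∀ k : ℤ, -(i : ℤ) < k → k ≤ j → (T.1 ^ k) x ∉ A} =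
      ⋂ k : ℤ, ⋂ _ : -(i : ℤ) < k, ⋂ _ : k ≤ j, {x | (T.1 ^ k) x ∈ A}ᶜ := by
    ext x
    simp
  change MeasurableSet {x | ∀ k : ℤ, -(i : ℤ) < k → k ≤ j → (T.1 ^ k) x ∉ A}
  exact this ▸ MeasurableSet.iInter fun k => MeasurableSet.iInter fun _ =>
    MeasurableSet.iInter fun _ => (measurableSet_zpow_mem T k hA).compl

/-- The set `D i j` holds the points with i floors below and j floors above in their column, and v
flips the column. The bound N on heights is what keeps v in `[Φ]_1`: its displacement is at most the
sum of those of the powers of T with exponent between -N and N. -/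
theorem Graphing.exists_reflection (T : Φ.l1) (N : ℕ) (D : ℕ → ℕ → Set X)
    (hD : ∀ i j, MeasurableSet (D i j))
    (hu : ∀ {i j i' j' x}, x ∈ D i j → x ∈ D i' j' → i = i' ∧ j = j')
    (hm : ∀ {i j x}, x ∈ D i j → (T.1.1 ^ ((j : ℤ) - i)) x ∈ D j i)
    (hN : ∀ {i j x}, x ∈ D i j → i + j < N) :
    ∃ v : Φ.l1, (∀ x, v.1.1 (v.1.1 x) = x) ∧
      (∀ {i j x}, x ∈ D i j → v.1.1 x = (T.1.1 ^ ((j : ℤ) - i)) x) ∧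
      ∀ {x}, (∀ i j, x ∉ D i j) → v.1.1 x = x := by
  classical
  let v : X → X := fun x =>
    if h : ∃ p : ℕ × ℕ, x ∈ D p.1 p.2 then (T.1.1 ^ ((h.choose.2 : ℤ) - h.choose.1)) x else x
  have hv1 : ∀ {i j x}, x ∈ D i j → v x = (T.1.1 ^ ((j : ℤ) - i)) x := by
    intro i j x hx
    have h : ∃ p : ℕ × ℕ, x ∈ D p.1 p.2 := ⟨(i, j), hx⟩
    obtain ⟨e1, e2⟩ := hu h.choose_spec hx
    simp only [v, dif_pos h, e1, e2]
  have hv2 : ∀ {x}, (∀ i j, x ∉ D i j) → v x = x := by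
    intro x hx
    have h : ¬ ∃ p : ℕ × ℕ, x ∈ D p.1 p.2 := fun ⟨p, hp⟩ => hx _ _ hp
    simp only [v, dif_neg h]
  have hvi : Function.Involutive v := by
    intro x
    by_cases h : ∃ i j, x ∈ D i j
    · obtain ⟨i, j, hx⟩ := h
      rw [hv1 hx, hv1 (hm hx), ← Equiv.Perm.mul_apply, ← zpow_add]
      simp
    · push Not at h
      rw [hv2 h, hv2 h]
  have hmem : hvi.toPerm ∈ mpPerm μ := by
    refine mem_mpPerm_of_cover (ι := Option (ℕ × ℕ)) _
      (f := fun o => o.elim (fun x => x) fun p => (T.1.1 ^ ((p.2 : ℤ) - p.1) : Equiv.Perm X))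
      (D := fun o => o.elim (⋃ i, ⋃ j, D i j)ᶜ fun p => D p.1 p.2) ?_ ?_ ?_
    · rintro (_ | p)
      · exact PresOn.id (MeasurableSet.iUnion fun i => MeasurableSet.iUnion fun j => hD i j).compl
      · exact PresOn.of_mem (zpow_mem T.1.2 _) (hD _ _)
    · rintro (_ | p) x hx
      · refine hv2 fun i j hij => hx ?_
        simp only [mem_iUnion]
        exact ⟨i, j, hij⟩
      · exact hv1 hx
    · intro x
      by_cases h : ∃ i j, x ∈ D i j
      · obtain ⟨i, j, hx⟩ := h
        exact ⟨some (i, j), hx⟩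
      · exact ⟨none, by simpa using h⟩
  refine ⟨⟨⟨hvi.toPerm, hmem⟩, ?_⟩, hvi, hv1, hv2⟩
  rw [mem_l1_iff]
  have hle : ∫⁻ x, Φ.d x (v x) ∂μ ≤
      ∫⁻ x, ∑ k ∈ Finset.Icc (-(N : ℤ)) N, Φ.d x ((T.1.1 ^ k) x) ∂μ := by
    refine lintegral_mono fun x => ?_
    by_cases h : ∃ i j, x ∈ D i j
    · obtain ⟨i, j, hx⟩ := h
      rw [hv1 hx]
      have := hN hx
      exact Finset.single_le_sum (f := fun k : ℤ => Φ.d x ((T.1.1 ^ k) x))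
        (fun _ _ => bot_le) (Finset.mem_Icc.2 ⟨by omega, by omega⟩)
    · push Not at h
      rw [hv2 h, d_self]
      exact bot_le
  refine ne_top_of_le_ne_top ?_ hle
  rw [lintegral_finsetSum _ fun k _ => measurable_d_id (measurable_zpow T.1 k)]
  exact ENNReal.sum_ne_top.2 fun k _ => mem_l1_iff.1 (zpow_mem T.2 k)

theorem Graphing.toL1_mem_involutionSubgroup {u : Φ.l1} (hu : ∀ x, u.1.1 (u.1.1 x) = x) :
    Φ.toL1 u ∈ Φ.involutionSubgroup :=
  Subgroup.subset_closure (toL1_mul_self hu)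

/-- Modulo involutions, `T` can be replaced by a map which is trivial on the floors, except the
bottom one, of the towers of bounded height over a given base. -/
theorem Graphing.exists_tower_mul (T : Φ.l1) {A : Set X} (hA : MeasurableSet A) (N : ℕ) :
    ∃ h : Φ.l1, Φ.toL1 h ∈ Φ.involutionSubgroup ∧
      (∀ i j x, x ∈ tower T.1.1 A (i + 1) j → i + 1 + j < N → (T * h).1.1 x = x) ∧
      (∀ j x, x ∈ tower T.1.1 A 0 j → j < N → (T * h).1.1 x = (T.1.1 ^ ((j : ℤ) + 1)) x) ∧
      ∀ x, (∀ i j, i + j < N → x ∉ tower T.1.1 A i j) → (T * h).1.1 x = T.1.1 x := by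
  -- The involution v flips whole columns, exchanging floors (i, j) and (j, i).
  obtain ⟨v, hv, hv1, hv2⟩ := exists_reflection T N
    (fun i j => {x | x ∈ tower T.1.1 A i j ∧ i + j < N})
    (fun i j => (measurableSet_tower T.1 hA i j).inter (MeasurableSet.const _))
    (fun h h' => tower_unique h.1 h'.1)
    (fun h => ⟨tower_shift h.1 (add_comm _ _), by have := h.2; omega⟩)
    (fun h => h.2)
  -- The involution w fixes the base and flips the rest of the column. Above the base, w, v and T
  -- successively give (i+1, j) → (j+1, i) → (i, j+1) → (i+1, j). A base point is fixed by w, sent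
  -- to the top by v and then back to the base by T.
  obtain ⟨w, hw, hw1, hw2⟩ := exists_reflection T N
    (fun i j => {x | x ∈ tower T.1.1 A (i + 1) j ∧ i + 1 + j < N})
    (fun i j => (measurableSet_tower T.1 hA (i + 1) j).inter (MeasurableSet.const _))
    (fun h h' => by have := tower_unique h.1 h'.1; omega)
    (fun {i j x} h => ⟨by
      have := tower_shift (i' := j + 1) (j' := i) h.1 (by omega)
      convert this using 3
      push_cast
      ring, by have := h.2; omega⟩)
    (fun h => by have := h.2; omega)
  refine ⟨v * w, ?_, fun i j x hx hij => ?_, fun j x hx hj => ?_, fun x hx => ?_⟩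
  · rw [map_mul]
    exact mul_mem (toL1_mem_involutionSubgroup hv) (toL1_mem_involutionSubgroup hw)
  · change T.1.1 (v.1.1 (w.1.1 x)) = x
    have hw' : w.1.1 x = (T.1.1 ^ ((j : ℤ) - i)) x := hw1 ⟨hx, hij⟩
    have hx' : (T.1.1 ^ ((j : ℤ) - i)) x ∈ tower T.1.1 A (j + 1) i := by
      have := tower_shift (i' := j + 1) (j' := i) hx (by omega)
      convert this using 3
      push_cast
      ring
    rw [hw', hv1 ⟨hx', by omega⟩, ← Equiv.Perm.mul_apply, ← Equiv.Perm.mul_apply,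
      ← zpow_one_add, ← zpow_add]
    have : 1 + ((i : ℤ) - ((j + 1 : ℕ) : ℤ)) + ((j : ℤ) - i) = 0 := by
      push_cast
      ring
    rw [this, zpow_zero, Equiv.Perm.one_apply]
  · change T.1.1 (v.1.1 (w.1.1 x)) = _
    have hw' : w.1.1 x = x := hw2 fun i j' h => by
      have := tower_unique hx h.1
      omega
    rw [hw', hv1 ⟨hx, by omega⟩, ← Equiv.Perm.mul_apply, ← zpow_one_add]
    congr 2
    push_cast
    ring
  · change T.1.1 (v.1.1 (w.1.1 x)) = _
    rw [hw2 fun i j h => hx _ _ h.2 h.1, hv2 fun i j h => hx _ _ h.2 h.1]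

variable [IsProbabilityMeasure μ]

theorem exists_measure_lt_of_antitone {E : ℕ → Set X} (hE : ∀ n, MeasurableSet (E n))
    (ha : Antitone E) (h : ∀ᵐ x ∂μ, ∃ n, x ∉ E n) {ε : ℝ≥0∞} (hε : ε ≠ 0) :
    ∃ n, μ (E n) < ε := by
  have h0 : μ (⋂ n, E n) = 0 := by
    refine measure_eq_zero_iff_ae_notMem.2 ?_
    filter_upwards [h] with x hx
    simpa using hx
  have := tendsto_measure_iInter_atTop (μ := μ) (fun n => (hE n).nullMeasurableSet) ha
    ⟨0, measure_ne_top _ _⟩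
  rw [h0] at this
  exact (this.eventually_lt_const (pos_iff_ne_zero.2 hε)).exists

/-- Poincaré recurrence: an orbit that visits A at some time visits it infinitely often in the
future. -/
theorem ae_exists_pos_zpow_mem (T : mpPerm μ) {A : Set X} (hA : MeasurableSet A) :
    ∀ᵐ x ∂μ, (∃ k : ℤ, (T.1 ^ k) x ∈ A) → ∃ j : ℕ, (T.1 ^ ((j : ℤ) + 1)) x ∈ A := by
  have hc : Conservative T.1 μ := T.2.1.conservative
  have h := hc.ae_mem_imp_frequently_image_mem hA.nullMeasurableSet
  have h' : ∀ k : ℤ, ∀ᵐ x ∂μ, (T.1 ^ k) x ∈ A →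
      ∃ᶠ n in atTop, T.1^[n] ((T.1 ^ k) x) ∈ A := fun k =>
    (T ^ k).2.1.quasiMeasurePreserving.ae h
  filter_upwards [ae_all_iff.2 h'] with x hx
  rintro ⟨k, hk⟩
  obtain ⟨n, hn, hnA⟩ := (hx k hk).forall_exists_of_atTop (k.natAbs + 1)
  -- The visit occurs at time n + k, which is at least 1 since n > |k|.
  refine ⟨(n + k - 1).toNat, ?_⟩
  rw [Equiv.Perm.iterate_eq_pow, ← zpow_natCast, ← Equiv.Perm.mul_apply, ← zpow_add] at hnA
  convert hnA using 3
  omega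

theorem ae_exists_mem_tower (T : mpPerm μ) {A : Set X} (hA : MeasurableSet A) :
    ∀ᵐ x ∂μ, (∃ k : ℤ, (T.1 ^ k) x ∈ A) → ∃ i j, x ∈ tower T.1 A i j := by
  filter_upwards [ae_exists_pos_zpow_mem T hA, ae_exists_pos_zpow_mem T⁻¹ hA] with x h1 h2
  intro h
  refine exists_mem_tower ?_ (h1 h)
  obtain ⟨k, hk⟩ := h
  obtain ⟨j, hj⟩ := h2 ⟨-k, by simpa using hk⟩
  refine ⟨j + 1, ?_⟩
  have : ((T⁻¹ : mpPerm μ).1 ^ ((j : ℤ) + 1)) x = (T.1 ^ (-((j + 1 : ℕ) : ℤ))) x := by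
    simp
  rwa [this] at hj

theorem measurableSet_not_mem_tower (T : mpPerm μ) {A : Set X} (hA : MeasurableSet A) (N : ℕ) :
    MeasurableSet {x | (∃ k : ℤ, (T.1 ^ k) x ∈ A) ∧ ∀ i j, i + j < N → x ∉ tower T.1 A i j} := by
  have : {x | (∃ k : ℤ, (T.1 ^ k) x ∈ A) ∧ ∀ i j, i + j < N → x ∉ tower T.1 A i j} =
      (⋃ k : ℤ, {x | (T.1 ^ k) x ∈ A}) ∩ ⋂ i, ⋂ j, ⋂ _ : i + j < N, (tower T.1 A i j)ᶜ := by
    ext x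
    simp
  exact this ▸ (MeasurableSet.iUnion fun k => measurableSet_zpow_mem T k hA).inter
    (MeasurableSet.iInter fun i => MeasurableSet.iInter fun j => MeasurableSet.iInter fun _ =>
      (measurableSet_tower T hA i j).compl)

theorem exists_measure_not_mem_tower_lt (T : mpPerm μ) {A : Set X} (hA : MeasurableSet A)
    {ε : ℝ≥0∞} (hε : ε ≠ 0) :
    ∃ N, μ {x | (∃ k : ℤ, (T.1 ^ k) x ∈ A) ∧ ∀ i j, i + j < N → x ∉ tower T.1 A i j} < ε := by
  refine exists_measure_lt_of_antitone (measurableSet_not_mem_tower T hA) ?_ ?_ hε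
  · intro m n hmn x hx
    exact ⟨hx.1, fun i j hij => hx.2 i j (hij.trans_le hmn)⟩
  · filter_upwards [ae_exists_mem_tower T hA] with x hx
    by_cases h : ∃ k : ℤ, (T.1 ^ k) x ∈ A
    · obtain ⟨i, j, hij⟩ := hx h
      exact ⟨i + j + 1, fun h' => h'.2 i j (by omega) hij⟩
    · exact ⟨0, fun h' => h h'.1⟩

/-- Every element of `[Φ]_1` coincides modulo involutions with one of small support. -/
theorem Graphing.exists_small_support (S : Φ.l1) {ε : ℝ≥0∞} (hε : ε ≠ 0) :
    ∃ h : Φ.l1, Φ.toL1 h ∈ Φ.involutionSubgroup ∧ μ {x | (S * h).1.1 x ≠ x} < ε := by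
  obtain ⟨g, hg, hgi, hg01⟩ := exists_injective_measurable_real X
  have hgk : ∀ k : ℤ, Measurable fun x => g ((S.1.1 ^ k) x) := fun k =>
    hg.comp (measurable_zpow S.1 k)
  have hSk : ∀ (k l : ℤ) x, (S.1.1 ^ k) ((S.1.1 ^ l) x) = (S.1.1 ^ (k + l)) x := fun k l x => by
    rw [zpow_add, Equiv.Perm.mul_apply]
  -- Here `A₀` consists of the points minimizing g on their orbit, one per orbit at most. On orbits
  -- where g has no minimum, `D m` consists of the points within 1 / (m + 1) of the infimum. The
  -- sets `D m` decrease to the empty set.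
  let A₀ : Set X := {x | ∀ l : ℤ, g x ≤ g ((S.1.1 ^ l) x)}
  let D : ℕ → Set X := fun m => {x | (∀ k : ℤ, g x < g ((S.1.1 ^ k) x) + 1 / ((m : ℝ) + 1)) ∧
    ∀ k : ℤ, (S.1.1 ^ k) x ∉ A₀}
  have hA₀ : MeasurableSet A₀ := by
    have : A₀ = ⋂ l : ℤ, {x | g x ≤ g ((S.1.1 ^ l) x)} := by
      ext x
      simp [A₀]
    exact this ▸ MeasurableSet.iInter fun l => measurableSet_le hg (hgk l)
  have hD : ∀ m, MeasurableSet (D m) := by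
    intro m
    have : D m = (⋂ k : ℤ, {x | g x < g ((S.1.1 ^ k) x) + 1 / ((m : ℝ) + 1)}) ∩
        ⋂ k : ℤ, {x | (S.1.1 ^ k) x ∈ A₀}ᶜ := by
      ext x
      simp [D]
    exact this ▸ (MeasurableSet.iInter fun k => measurableSet_lt hg ((hgk k).add_const _)).inter
      (MeasurableSet.iInter fun k => (measurableSet_zpow_mem S.1 k hA₀).compl)
  have hDa : Antitone D := by
    intro m n hmn x hx
    refine ⟨fun k => (hx.1 k).trans_le ?_, hx.2⟩
    gcongr
  have hDe : ∀ x, ∃ m, x ∉ D m := by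
    intro x
    by_contra! hx
    refine (hx 0).2 0 fun l => ?_
    rw [zpow_zero, Equiv.Perm.one_apply]
    refine le_of_forall_pos_lt_add fun η hη => ?_
    obtain ⟨m, hm⟩ := exists_nat_one_div_lt hη
    exact ((hx m).1 l).trans (by linarith)
  have hε2 : ε / 2 ≠ 0 := by simpa using hε
  obtain ⟨m, hm⟩ := exists_measure_lt_of_antitone hD hDa (Eventually.of_forall hDe)
    (μ := μ) hε2
  -- This base meets every orbit. The return map is trivial on `A₀`, so only `D m` and the columns
  -- that are too high contribute to the support.
  set A := A₀ ∪ D m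
  have hA : MeasurableSet A := hA₀.union (hD m)
  have hmeet : ∀ x, ∃ k : ℤ, (S.1.1 ^ k) x ∈ A := by
    intro x
    by_cases hx : ∃ k : ℤ, (S.1.1 ^ k) x ∈ A₀
    · obtain ⟨k, hk⟩ := hx
      exact ⟨k, Or.inl hk⟩
    · push Not at hx
      have hb : BddBelow (range fun k : ℤ => g ((S.1.1 ^ k) x)) :=
        ⟨0, by rintro _ ⟨k, rfl⟩; exact (hg01 _).1.le⟩
      have hpos : (0 : ℝ) < 1 / ((m : ℝ) + 1) := by positivity
      obtain ⟨k, hk⟩ := exists_lt_of_ciInf_lt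
        (lt_add_of_pos_right (⨅ k : ℤ, g ((S.1.1 ^ k) x)) hpos)
      refine ⟨k, Or.inr ⟨fun l => ?_, fun l => ?_⟩⟩
      · rw [hSk]
        have := ciInf_le hb (l + k)
        linarith
      · rw [hSk]
        exact hx _
  obtain ⟨N, hN⟩ := exists_measure_not_mem_tower_lt S.1 hA hε2
  obtain ⟨h, hJ, h1, h2, -⟩ := exists_tower_mul S hA N
  refine ⟨h, hJ, ?_⟩
  refine (measure_mono (t := D m ∪ {x | (∃ k : ℤ, (S.1.1 ^ k) x ∈ A) ∧
    ∀ i j, i + j < N → x ∉ tower S.1.1 A i j}) ?_).trans_lt ((measure_union_le _ _).trans_lt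
      ((ENNReal.add_lt_add hm hN).trans_eq (ENNReal.add_halves ε)))
  intro x hx
  by_contra hx'
  rw [mem_union, not_or] at hx'
  obtain ⟨hxD, hxT⟩ := hx'
  have : ∃ i j, i + j < N ∧ x ∈ tower S.1.1 A i j := by
    by_contra! hn
    exact hxT ⟨hmeet x, hn⟩
  obtain ⟨i, j, hij, hxij⟩ := this
  refine hx ?_
  rcases i with _ | i
  · rw [h2 j x hxij (by omega)]
    have hxA : x ∈ A := by simpa using hxij.1
    have hx0 : x ∈ A₀ := hxA.resolve_right hxD
    -- The return point lies on the orbit of x, which meets `A₀`, so it cannot be in `D m`. Both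
    -- points then minimize g on the same orbit, hence coincide.
    have hy0 : (S.1.1 ^ ((j : ℤ) + 1)) x ∈ A₀ := by
      refine hxij.2.1.resolve_right fun hd => hd.2 (-((j : ℤ) + 1)) ?_
      rw [hSk]
      simpa using hx0
    refine hgi (le_antisymm ?_ (hx0 _))
    have := hy0 (-((j : ℤ) + 1))
    rw [hSk] at this
    simpa using this
  · exact h1 i j x hxij hij

end Towers

/-! ### Commutators are limits of products of involutions -/

section Commutators

open Filter Topology
open scoped commutatorElement

variable {X : Type*} [MeasurableSpace X] [StandardBorelSpace X] {μ : Measure X} {Φ : Graphing μ}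

instance Graphing.normal_involutionSubgroup : Φ.involutionSubgroup.Normal := by
  refine ⟨fun U hU V => ?_⟩
  induction hU using Subgroup.closure_induction with
  | mem U hU =>
    refine Subgroup.subset_closure ?_
    change V * U * V⁻¹ * (V * U * V⁻¹) = 1
    have hU' : U * U = 1 := hU
    calc V * U * V⁻¹ * (V * U * V⁻¹) = V * (U * U) * V⁻¹ := by group
      _ = 1 := by rw [hU', mul_one, mul_inv_cancel]
  | one => simp
  | mul a b _ _ iha ihb =>
    have : V * (a * b) * V⁻¹ = V * a * V⁻¹ * (V * b * V⁻¹) := by group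
    exact this ▸ mul_mem iha ihb
  | inv a _ iha =>
    have : V * a⁻¹ * V⁻¹ = (V * a * V⁻¹)⁻¹ := by group
    exact this ▸ inv_mem iha

/-- Upper bound for the distance between `H Q` and `Q H`, when `Q` is supported on `E` and `H` is
trivial on `E`, except on a set `K` on which it coincides with `T`. -/
theorem Graphing.edist_mul_comm_le {Q H T : Φ.l1} {E K : Set X} (hK : MeasurableSet K)
    (hKE : K ⊆ E) (hQ : ∀ x ∉ E, Q.1.1 x = x) (hHE : ∀ x ∈ E, x ∉ K → H.1.1 x = x)
    (hHK : ∀ x ∈ K, H.1.1 x = T.1.1 x) {η : ℝ≥0∞}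
    (hη : ∀ s, μ s ≤ μ K + μ K →
      ∫⁻ x in s, Φ.d x (T.1.1 x) ∂μ ≤ η ∧ ∫⁻ x in s, Φ.d x (Q.1.1 x) ∂μ ≤ η) :
    edist (Φ.toL1 (H * Q)) (Φ.toL1 (Q * H)) ≤ 5 * η := by
  -- On L the two composites are compared through Q x, x and H x. Off L they agree, except where x
  -- is outside E but H x falls in K; there the error is the displacement of Q at H x.
  set L : Set X := K ∪ Q.1.1 ⁻¹' K
  have hQm := measurable_val Q.1
  have hHm := measurable_val H.1
  have hL : MeasurableSet L := hK.union (hQm hK)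
  have hμL : μ L ≤ μ K + μ K := by
    refine (measure_union_le _ _).trans ?_
    rw [measure_preimage_mp Q.1 hK]
  have hμK : μ K ≤ μ K + μ K := le_self_add
  have hfQ : Measurable fun x => Φ.d x (Q.1.1 x) := measurable_d_perm Q.1
  have hfT : Measurable fun x => Φ.d x (T.1.1 x) := measurable_d_perm T.1
  have hQE : ∀ x, x ∈ E → Q.1.1 x ∈ E := by
    intro x hx
    by_contra h
    exact h ((Q.1.1.injective (hQ _ h)).symm ▸ hx)
  let aT : X → ℝ≥0∞ := K.indicator fun x => Φ.d x (T.1.1 x)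
  let aQ : X → ℝ≥0∞ := K.indicator fun x => Φ.d x (Q.1.1 x)
  let bQ : X → ℝ≥0∞ := L.indicator fun x => Φ.d x (Q.1.1 x)
  let cQ : X → ℝ≥0∞ := (H.1.1.symm ⁻¹' L).indicator fun x => Φ.d x (Q.1.1 x)
  have hL' : MeasurableSet (H.1.1.symm ⁻¹' L) := H.1.2.2.measurable hL
  have haT : Measurable aT := hfT.indicator hK
  have haQ : Measurable aQ := hfQ.indicator hK
  have hbQ : Measurable bQ := hfQ.indicator hL
  have hcQ : Measurable cQ := hfQ.indicator hL'
  have hHT : ∀ x ∈ E, Φ.d x (H.1.1 x) ≤ aT x := by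
    intro x hx
    by_cases hxK : x ∈ K
    · simp [aT, hxK, hHK x hxK]
    · simp [hHE x hx hxK, d_self]
  have key : ∀ x, Φ.d (H.1.1 (Q.1.1 x)) (Q.1.1 (H.1.1 x)) ≤
      aT (Q.1.1 x) + (aT x + (bQ x + (cQ (H.1.1 x) + aQ (H.1.1 x)))) := by
    intro x
    by_cases hxL : x ∈ L
    · have hxE : x ∈ E := by
        rcases hxL with h | h
        · exact hKE h
        · by_contra hn
          exact hn (hKE (by simpa [hQ x hn] using h))
      have h1 : Φ.d (H.1.1 (Q.1.1 x)) (Q.1.1 x) ≤ aT (Q.1.1 x) := by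
        rw [d_comm]
        exact hHT _ (hQE x hxE)
      have h2 : Φ.d (Q.1.1 x) x ≤ bQ x := by
        rw [d_comm]
        simp [bQ, hxL]
      have h3 : Φ.d x (H.1.1 x) ≤ aT x := hHT x hxE
      have h4 : Φ.d (H.1.1 x) (Q.1.1 (H.1.1 x)) ≤ cQ (H.1.1 x) := by
        simp [cQ, hxL]
      calc Φ.d (H.1.1 (Q.1.1 x)) (Q.1.1 (H.1.1 x))
          ≤ Φ.d (H.1.1 (Q.1.1 x)) (Q.1.1 x) + (Φ.d (Q.1.1 x) x + (Φ.d x (H.1.1 x) +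
              Φ.d (H.1.1 x) (Q.1.1 (H.1.1 x)))) :=
            (d_triangle _ (Q.1.1 x) _).trans (add_le_add_right ((d_triangle _ x _).trans
              (add_le_add_right (d_triangle _ (H.1.1 x) _) _)) _)
        _ ≤ aT (Q.1.1 x) + (bQ x + (aT x + cQ (H.1.1 x))) := by gcongr
        _ ≤ aT (Q.1.1 x) + (aT x + (bQ x + (cQ (H.1.1 x) + aQ (H.1.1 x)))) := by
            rw [add_left_comm (bQ x)]
            gcongr
            exact le_self_add
    · have hxK : x ∉ K := fun h => hxL (Or.inl h)
      have hQK : Q.1.1 x ∉ K := fun h => hxL (Or.inr h)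
      by_cases hxE : x ∈ E
      · rw [hHE x hxE hxK, hHE _ (hQE x hxE) hQK, d_self]
        exact bot_le
      · rw [hQ x hxE]
        by_cases hHx : H.1.1 x ∈ K
        · have : Φ.d (H.1.1 x) (Q.1.1 (H.1.1 x)) = aQ (H.1.1 x) := by simp [aQ, hHx]
          rw [this]
          exact le_add_left (le_add_left (le_add_left le_add_self))
        · have hHE' : H.1.1 x ∉ E := by
            intro h
            exact hxE ((H.1.1.injective (hHE _ h hHx)) ▸ h)
          rw [hQ _ hHE', d_self]
          exact bot_le
  have iT : ∫⁻ x, aT x ∂μ ≤ η := by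
    rw [lintegral_indicator hK]
    exact (hη K hμK).1
  have iQ : ∫⁻ x, aQ x ∂μ ≤ η := by
    rw [lintegral_indicator hK]
    exact (hη K hμK).2
  have jQ : ∫⁻ x, bQ x ∂μ ≤ η := by
    rw [lintegral_indicator hL]
    exact (hη L hμL).2
  have kQ : ∫⁻ x, cQ x ∂μ ≤ η := by
    rw [lintegral_indicator hL']
    refine (hη _ ?_).2
    rwa [H.1.2.2.measure_preimage hL.nullMeasurableSet]
  rw [edist_toL1]
  calc ∫⁻ x, Φ.d (H.1.1 (Q.1.1 x)) (Q.1.1 (H.1.1 x)) ∂μ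
      ≤ ∫⁻ x, (aT (Q.1.1 x) + (aT x + (bQ x + (cQ (H.1.1 x) + aQ (H.1.1 x))))) ∂μ :=
        lintegral_mono key
    _ = ∫⁻ x, aT x ∂μ + (∫⁻ x, aT x ∂μ + (∫⁻ x, bQ x ∂μ + (∫⁻ x, cQ x ∂μ +
          ∫⁻ x, aQ x ∂μ))) := by
        rw [lintegral_add_left (f := fun x => aT (Q.1.1 x)) (haT.comp hQm), lintegral_add_left haT, lintegral_add_left hbQ,
          lintegral_add_left (f := fun x => cQ (H.1.1 x)) (hcQ.comp hHm),
          lintegral_comp_mp (f := Q.1) haT,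
          lintegral_comp_mp (f := H.1) hcQ, lintegral_comp_mp (f := H.1) haQ]
    _ ≤ η + (η + (η + (η + η))) := by gcongr
    _ = 5 * η := by ring

theorem commutator_eq_of_mem {G : Type*} [Group G] {J : Subgroup G} [J.Normal] {a b h : G}
    (hh : h ∈ J) : ⁅a, b * h⁆⁻¹ * ⁅a, b⁆ ∈ J := by
  rw [← QuotientGroup.eq_one_iff]
  have : (QuotientGroup.mk h : G ⧸ J) = 1 := (QuotientGroup.eq_one_iff h).2 hh
  simp only [QuotientGroup.mk_mul, QuotientGroup.mk_inv, commutatorElement_def, this]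
  group

theorem commutator_mul_left_mem {G : Type*} [Group G] {J I : Subgroup G} [J.Normal] {a b h : G}
    (hJI : J ≤ I) (hh : h ∈ J) (hI : ⁅a * h, b⁆ ∈ I) : ⁅a, b⁆ ∈ I := by
  have h1 : ⁅a * h, b⁆⁻¹ * ⁅a, b⁆ ∈ J := by
    rw [← QuotientGroup.eq_one_iff]
    have : (QuotientGroup.mk h : G ⧸ J) = 1 := (QuotientGroup.eq_one_iff h).2 hh
    simp only [QuotientGroup.mk_mul, QuotientGroup.mk_inv, commutatorElement_def, this]
    group
  have := mul_mem hI (hJI h1)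
  rwa [mul_inv_cancel_left] at this

variable [IsProbabilityMeasure μ]

/-- Take the columns of T over the complement of E. Almost every point of E on an orbit leaving E is
above the base of a column, and T is trivial on the other orbits. Hence, for large N, T h is trivial
on E outside a small set, with h in J, and almost commutes with Q. -/
theorem Graphing.commutator_mem_of_support {Q T : Φ.l1} {E : Set X} (hE : MeasurableSet E)
    (hQ : ∀ x ∉ E, Q.1.1 x = x) (hT : ∀ x, (∀ k : ℤ, (T.1.1 ^ k) x ∈ E) → T.1.1 x = x) :
    ⁅Φ.toL1 Q, Φ.toL1 T⁆ ∈ Φ.involutionSubgroup.topologicalClosure := by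
  rw [← SetLike.mem_coe, Subgroup.topologicalClosure_coe, EMetric.mem_closure_iff]
  intro ε hε
  obtain ⟨η, hη0, hηε⟩ : ∃ η : ℝ≥0∞, η ≠ 0 ∧ 5 * η < ε := by
    obtain ⟨ε', h1, h2⟩ := exists_between hε
    refine ⟨ε' / 5, by simpa using h1.ne', ?_⟩
    rwa [ENNReal.mul_div_cancel (by simp) (by simp)]
  obtain ⟨δ₁, hδ₁, h₁⟩ := exists_pos_setLIntegral_lt_of_measure_lt (mem_l1_iff.1 T.2) hη0
  obtain ⟨δ₂, hδ₂, h₂⟩ := exists_pos_setLIntegral_lt_of_measure_lt (mem_l1_iff.1 Q.2) hη0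
  have hδ : min δ₁ δ₂ / 2 ≠ 0 := by simpa using ⟨hδ₁.ne', hδ₂.ne'⟩
  obtain ⟨N, hN⟩ := exists_measure_not_mem_tower_lt T.1 hE.compl hδ
  obtain ⟨h, hJ, t1, -, t3⟩ := exists_tower_mul T hE.compl N
  set R := {x | (∃ k : ℤ, (T.1.1 ^ k) x ∈ Eᶜ) ∧ ∀ i j, i + j < N → x ∉ tower T.1.1 Eᶜ i j}
  have hR : MeasurableSet R := measurableSet_not_mem_tower T.1 hE.compl N
  have hμ : μ (E ∩ R) + μ (E ∩ R) < min δ₁ δ₂ := by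
    have : μ (E ∩ R) < min δ₁ δ₂ / 2 := (measure_mono inter_subset_right).trans_lt hN
    exact (ENNReal.add_lt_add this this).trans_eq (ENNReal.add_halves _)
  have hd := edist_mul_comm_le (Q := Q) (H := T * h) (T := T) (hE.inter hR)
    inter_subset_left hQ ?_ (fun x hx => t3 x hx.2.2) (η := η) (fun s hs =>
      ⟨(h₁ s (hs.trans_lt (hμ.trans_le (min_le_left _ _)))).le,
        (h₂ s (hs.trans_lt (hμ.trans_le (min_le_right _ _)))).le⟩)
  · refine ⟨_, commutator_eq_of_mem (a := Φ.toL1 Q) (b := Φ.toL1 T) hJ, ?_⟩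
    refine lt_of_eq_of_lt ?_ (hd.trans_lt hηε)
    have hr : ∀ a c : Φ.l1FullGroup, edist c (a⁻¹ * c) = edist 1 a := fun a c => by
      rw [← edist_mul_right c _ (c⁻¹ * a), ← edist_comm a]
      congr 1 <;> group
    rw [hr, edist_comm, ← edist_mul_right _ _ (Φ.toL1 (T * h * Q)), edist_comm]
    congr 1
    · simp only [map_mul, commutatorElement_def]
      group
  · intro x hxE hx
    by_cases hk : ∀ k : ℤ, (T.1.1 ^ k) x ∈ E
    · rw [t3 x fun i j _ hij => hij.1 (hk _)]
      exact hT x hk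
    · push Not at hk
      have : ∃ i j, i + j < N ∧ x ∈ tower T.1.1 Eᶜ i j := by
        by_contra! hn
        exact hx ⟨hxE, hk, hn⟩
      obtain ⟨i, j, hij, hxij⟩ := this
      rcases i with _ | i
      · exact absurd hxE (by simpa using hxij.1)
      · exact t1 i j x hxij hij

/-- Used to erase t on the orbits that never leave the support E, where there is no base for
columns. The powers are kept off C so that those orbits are unchanged. -/
theorem Graphing.exists_trivial_on_invariant (T : Φ.l1) {C : Set X} (hC : MeasurableSet C)
    (hTC : ∀ x, T.1.1 x ∈ C ↔ x ∈ C) :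
    ∃ T' : Φ.l1, (∀ x ∈ C, T'.1.1 x = x) ∧ ∀ x ∉ C, ∀ k : ℤ, (T'.1.1 ^ k) x = (T.1.1 ^ k) x := by
  classical
  have hTC' : ∀ x, T.1.1.symm x ∈ C ↔ x ∈ C := fun x => by
    rw [← hTC, Equiv.apply_symm_apply]
  let e : Equiv.Perm X :=
    { toFun := fun x => if x ∈ C then x else T.1.1 x
      invFun := fun x => if x ∈ C then x else T.1.1.symm x
      left_inv := fun x => by by_cases h : x ∈ C <;> simp [h, hTC]
      right_inv := fun x => by by_cases h : x ∈ C <;> simp [h, hTC'] }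
  have he1 : ∀ x ∈ C, e x = x := fun x hx => if_pos hx
  have he2 : ∀ x ∉ C, e x = T.1.1 x := fun x hx => if_neg hx
  have he3 : ∀ x ∉ C, e⁻¹ x = T.1.1⁻¹ x := fun x hx => if_neg hx
  have hmem : e ∈ mpPerm μ := mem_mpPerm_of_piecewise e (one_mem _) T.1.2 hC he1 he2
  refine ⟨⟨⟨e, hmem⟩, mem_l1_of_eq_or_eq T.2 fun x => ?_⟩, he1, fun x hx k => ?_⟩
  · by_cases h : x ∈ C
    · exact Or.inr (he1 x h)
    · exact Or.inl (he2 x h)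
  · have hinv : ∀ k : ℤ, (T.1.1 ^ k) x ∉ C := by
      intro k
      induction k using Int.induction_on with
      | zero => simpa using hx
      | succ k ih => rwa [add_comm, zpow_one_add, Equiv.Perm.mul_apply, hTC]
      | pred k ih =>
        rw [sub_eq_add_neg, add_comm, zpow_add, Equiv.Perm.mul_apply, zpow_neg_one]
        exact fun h => ih ((hTC' _).1 h)
    change (e ^ k) x = _
    induction k using Int.induction_on with
    | zero => simp
    | succ k ih =>
      rw [add_comm, zpow_one_add, zpow_one_add, Equiv.Perm.mul_apply, Equiv.Perm.mul_apply, ih,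
        he2 _ (hinv _)]
    | pred k ih =>
      rw [sub_eq_add_neg, add_comm, zpow_add, zpow_add, Equiv.Perm.mul_apply,
        Equiv.Perm.mul_apply, ih, zpow_neg_one, zpow_neg_one, he3 _ (hinv _)]

/-- For fixed s, the good t form a closed set, so t may be perturbed. Modulo J, s has support E so
small that trivializing t on C, the union of its orbits contained in E, moves it by less than ε. -/
theorem Graphing.commutator_le_closure_involutionSubgroup :
    commutator Φ.l1FullGroup ≤ Φ.involutionSubgroup.topologicalClosure := by
  set J := Φ.involutionSubgroup
  rw [commutator_def, Subgroup.commutator_le]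
  rintro S - T -
  obtain ⟨s, rfl⟩ := toL1_surjective S
  obtain ⟨t, rfl⟩ := toL1_surjective T
  have hcl : IsClosed {t : Φ.l1FullGroup | ⁅Φ.toL1 s, t⁆ ∈ J.topologicalClosure} := by
    have hc : Continuous fun t : Φ.l1FullGroup => ⁅Φ.toL1 s, t⁆ := by
      simp only [commutatorElement_def]
      fun_prop
    exact J.isClosed_topologicalClosure.preimage hc
  suffices h : Φ.toL1 t ∈ closure {t : Φ.l1FullGroup | ⁅Φ.toL1 s, t⁆ ∈ J.topologicalClosure} by
    rwa [hcl.closure_eq] at h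
  rw [EMetric.mem_closure_iff]
  intro ε hε
  obtain ⟨δ, hδ, hδt⟩ := exists_pos_setLIntegral_lt_of_measure_lt (mem_l1_iff.1 t.2) hε.ne'
  obtain ⟨h, hJ, hμ⟩ := exists_small_support s hδ.ne'
  set E := {x | (s * h).1.1 x ≠ x}
  have hE : MeasurableSet E := measurableSet_ne_mp (s * h).1 1
  let C : Set X := {x | ∀ k : ℤ, (t.1.1 ^ k) x ∈ E}
  have hC : MeasurableSet C := by
    have : C = ⋂ k : ℤ, {x | (t.1.1 ^ k) x ∈ E} := by
      ext x
      simp [C]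
    exact this ▸ MeasurableSet.iInter fun k => measurableSet_zpow_mem t.1 k hE
  have hCE : C ⊆ E := fun x hx => by simpa using hx 0
  have htC : ∀ x, t.1.1 x ∈ C ↔ x ∈ C := by
    intro x
    constructor
    · intro hx k
      have := hx (k - 1)
      rwa [← Equiv.Perm.mul_apply, ← zpow_add_one, sub_add_cancel] at this
    · intro hx k
      rw [← Equiv.Perm.mul_apply, ← zpow_add_one]
      exact hx _
  obtain ⟨t', ht1, ht2⟩ := exists_trivial_on_invariant t hC htC
  refine ⟨Φ.toL1 t', ?_, ?_⟩
  · refine commutator_mul_left_mem J.le_topologicalClosure hJ ?_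
    rw [← map_mul]
    refine commutator_mem_of_support hE (fun x hx => not_not.1 hx) fun x hx => ?_
    refine ht1 x ?_
    by_contra hxC
    exact hxC fun k => ht2 x hxC k ▸ hx k
  · refine lt_of_le_of_lt ?_ (hδt C ((measure_mono hCE).trans_lt hμ))
    rw [edist_toL1, ← lintegral_indicator hC]
    refine lintegral_mono fun x => ?_
    by_cases hx : x ∈ C
    · simp [hx, ht1 x hx, d_comm]
    · have := ht2 x hx 1
      rw [zpow_one, zpow_one] at this
      simp [this, d_self]

end Commutators

/-! ### Countable covers of the relation by partial maps -/

section Words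

open Filter Topology
open scoped commutatorElement

variable {X : Type*} [MeasurableSpace X] {μ : Measure X} {Φ : Graphing μ}

/-- The inverse of a partial isomorphism. -/
def PartialIso.symm (φ : PartialIso μ) : PartialIso μ where
  dom := φ.rng
  rng := φ.dom
  measurableSet_dom := φ.measurableSet_rng
  measurableSet_rng := φ.measurableSet_dom
  toEquiv := φ.toEquiv.symm
  measurePreserving := φ.measurePreserving.symm

open Classical in
/-- The extension of a partial isomorphism by the identity. -/
noncomputable def PartialIso.extend (φ : PartialIso μ) (x : X) : X :=
  if h : x ∈ φ.dom then φ.toEquiv ⟨x, h⟩ else x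

theorem PartialIso.extend_apply (φ : PartialIso μ) {x : X} (h : x ∈ φ.dom) :
    φ.extend x = φ.toEquiv ⟨x, h⟩ := dif_pos h

theorem PartialIso.presOn (φ : PartialIso μ) : PresOn μ φ.extend φ.dom := by
  classical
  refine ⟨?_, φ.measurableSet_dom, fun x hx y hy h => ?_, fun B hB hBm => ?_⟩
  · exact Measurable.dite (f := fun x : φ.dom => (φ.toEquiv x : X))
      (g := fun x : (φ.domᶜ : Set X) => (x : X))
      (measurable_subtype_coe.comp φ.toEquiv.measurable) measurable_subtype_coe
      φ.measurableSet_dom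
  · rw [φ.extend_apply hx, φ.extend_apply hy] at h
    exact congrArg Subtype.val (φ.toEquiv.injective (Subtype.ext h))
  · have hS : MeasurableSet (φ.toEquiv '' (Subtype.val ⁻¹' B)) :=
      φ.toEquiv.measurableSet_image.2 (measurable_subtype_coe hBm)
    have h1 := φ.measurePreserving.measure_preimage hS.nullMeasurableSet
    rw [preimage_image_eq _ φ.toEquiv.injective,
      comap_subtype_coe_apply φ.measurableSet_rng, comap_subtype_coe_apply φ.measurableSet_dom,
      Subtype.image_preimage_coe, inter_eq_right.2 hB] at h1
    rw [h1, ← image_comp]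
    congr 1
    ext y
    constructor
    · rintro ⟨x, hx, rfl⟩
      exact ⟨⟨x, hB hx⟩, hx, (φ.extend_apply (hB hx)).symm⟩
    · rintro ⟨⟨x, hx'⟩, hx, rfl⟩
      exact ⟨x, hx, φ.extend_apply hx'⟩

variable [StandardBorelSpace X]

variable (Φ) in
-- The family consists of the words of length n in the elements of Φ and their inverses, each with
-- its natural domain.
theorem Graphing.exists_countable_reach (n : ℕ) :
    ∃ S : Set ((X → X) × Set X), S.Countable ∧
      (∀ p ∈ S, PresOn μ p.1 p.2 ∧ ∀ x ∈ p.2, Φ.Reach n x (p.1 x)) ∧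
      ∀ x y, Φ.Reach n x y → ∃ p ∈ S, x ∈ p.2 ∧ p.1 x = y := by
  induction n with
  | zero =>
    refine ⟨{(fun x => x, univ)}, countable_singleton _, ?_, ?_⟩
    · rintro p rfl
      exact ⟨PresOn.id MeasurableSet.univ, fun x _ => rfl⟩
    · rintro x y hxy
      exact ⟨_, rfl, trivial, hxy⟩
  | succ n ih =>
    obtain ⟨S, hS, hS1, hS2⟩ := ih
    let G : Set (PartialIso μ) := Φ.carrier ∪ PartialIso.symm '' Φ.carrier
    have hG : G.Countable := Φ.countable.union (Φ.countable.image _)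
    refine ⟨image2 (fun p φ => (PartialIso.extend φ ∘ p.1, p.2 ∩ p.1 ⁻¹' φ.dom)) S G,
      hS.image2 hG _, ?_, ?_⟩
    · rintro _ ⟨p, hp, φ, hφ, rfl⟩
      refine ⟨φ.presOn.comp (hS1 p hp).1, fun x hx => ⟨p.1 x, (hS1 p hp).2 x hx.1, ?_⟩⟩
      rcases hφ with hφ | ⟨φ, hφ, rfl⟩
      · exact ⟨φ, hφ, Or.inl ⟨hx.2, (φ.extend_apply hx.2).symm⟩⟩
      · refine ⟨φ, hφ, Or.inr ?_⟩
        simp only [Function.comp_apply]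
        rw [φ.symm.extend_apply hx.2]
        exact ⟨(φ.toEquiv.symm ⟨p.1 x, hx.2⟩).2,
          congrArg Subtype.val (φ.toEquiv.apply_symm_apply ⟨p.1 x, hx.2⟩)⟩
    · rintro x y ⟨z, hz, φ, hφ, ⟨h, e⟩ | ⟨h, e⟩⟩
      · obtain ⟨p, hp, hx, rfl⟩ := hS2 x z hz
        exact ⟨_, ⟨p, hp, φ, Or.inl hφ, rfl⟩, ⟨hx, h⟩, (φ.extend_apply h).trans e⟩
      · obtain ⟨p, hp, hx, rfl⟩ := hS2 x z hz
        have h' : p.1 x ∈ φ.rng := e ▸ (φ.toEquiv ⟨y, h⟩).2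
        refine ⟨_, ⟨p, hp, φ.symm, Or.inr ⟨φ, hφ, rfl⟩, rfl⟩, ⟨hx, h'⟩, ?_⟩
        refine (φ.symm.extend_apply h').trans ?_
        have : (⟨p.1 x, h'⟩ : φ.rng) = φ.toEquiv ⟨y, h⟩ := Subtype.ext e.symm
        change ((φ.toEquiv.symm ⟨p.1 x, h'⟩ : φ.dom) : X) = y
        rw [this, φ.toEquiv.symm_apply_apply]

variable (Φ) in
/-- The equivalence relation is covered by countably many measure-preserving partial maps. -/
theorem Graphing.exists_seq_presOn :
    ∃ (f : ℕ → X → X) (D : ℕ → Set X), (∀ k, PresOn μ (f k) (D k)) ∧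
      (∀ k, ∃ n : ℕ, ∀ x ∈ D k, Φ.d x (f k x) ≤ n) ∧
      ∀ x y, Φ.Rel x y → ∃ k, x ∈ D k ∧ f k x = y := by
  choose S hS hS1 hS2 using Φ.exists_countable_reach
  -- The map with empty domain is added to make the family nonempty, so that a sequence can
  -- enumerate it.
  have hne : (⋃ n, S n ∪ {((fun x : X => x), (∅ : Set X))}).Nonempty :=
    ⟨_, mem_iUnion.2 ⟨0, Or.inr rfl⟩⟩
  obtain ⟨p, hp⟩ := (countable_iUnion fun n =>
    (hS n).union (countable_singleton ((fun x : X => x), (∅ : Set X)))).exists_eq_range hne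
  have hk : ∀ k, ∃ n, p k ∈ S n ∨ p k = ((fun x : X => x), (∅ : Set X)) := by
    intro k
    have : p k ∈ ⋃ n, S n ∪ {((fun x : X => x), (∅ : Set X))} := hp ▸ mem_range_self k
    simpa only [mem_iUnion, mem_union, mem_singleton_iff] using this
  refine ⟨fun k => (p k).1, fun k => (p k).2, fun k => ?_, fun k => ?_, fun x y hxy => ?_⟩
  · obtain ⟨n, h | h⟩ := hk k
    · exact (hS1 n _ h).1
    · simp only [h]
      exact PresOn.id MeasurableSet.empty
  · obtain ⟨n, h | h⟩ := hk k
    · exact ⟨n, fun x hx => d_le ((hS1 n _ h).2 x hx)⟩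
    · exact ⟨n, fun x hx => by simp [h] at hx⟩
  · obtain ⟨n, hn⟩ := rel_iff_reach.1 hxy
    obtain ⟨q, hq, hx, e⟩ := hS2 n x y hn
    have : q ∈ range p := hp ▸ mem_iUnion.2 ⟨n, Or.inl hq⟩
    obtain ⟨k, rfl⟩ := this
    exact ⟨k, hx, e⟩

variable (Φ) in
-- Each partial map is cut, for every rational q, to the points with g x < q < g (f x), so that q
-- separates the domain from the image. Only pairs with g increasing are reached, whence the two
-- cases in the conclusion.
theorem Graphing.exists_seq_disjoint :
    ∃ (f : ℕ → X → X) (D : ℕ → Set X), (∀ k, PresOn μ (f k) (D k)) ∧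
      (∀ k, ∃ n : ℕ, ∀ x ∈ D k, Φ.d x (f k x) ≤ n) ∧ (∀ k, ∀ x ∈ D k, f k x ∉ D k) ∧
      ∀ x y, Φ.Rel x y → x ≠ y → ∃ k, (x ∈ D k ∧ f k x = y) ∨ (y ∈ D k ∧ f k y = x) := by
  obtain ⟨f, D, h1, h2, h3⟩ := Φ.exists_seq_presOn
  obtain ⟨g, hg, hgi, -⟩ := exists_injective_measurable_real X
  obtain ⟨e, he⟩ := exists_surjective_nat (ℕ × ℚ)
  have key : ∀ x y, Φ.Rel x y → g x < g y →
      ∃ k, (x ∈ D (e k).1 ∧ g x < ((e k).2 : ℝ) ∧ ((e k).2 : ℝ) < g (f (e k).1 x)) ∧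
        f (e k).1 x = y := by
    intro x y hxy hlt
    obtain ⟨q, hq1, hq2⟩ := exists_rat_btwn hlt
    obtain ⟨k, hk1, hk2⟩ := h3 x y hxy
    obtain ⟨m, hm⟩ := he (k, q)
    exact ⟨m, by simp [hm, hk1, hk2, hq1, hq2]⟩
  refine ⟨fun k => f (e k).1, fun k => {x | x ∈ D (e k).1 ∧ g x < ((e k).2 : ℝ) ∧
    ((e k).2 : ℝ) < g (f (e k).1 x)}, fun k => ?_, fun k => ?_, fun k x hx hx' => ?_,
    fun x y hxy hne => ?_⟩
  · refine (h1 _).mono ?_ fun x hx => hx.1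
    exact (h1 _).measurableSet.inter ((measurableSet_lt hg measurable_const).inter
      (measurableSet_lt measurable_const (hg.comp (h1 _).measurable)))
  · obtain ⟨n, hn⟩ := h2 (e k).1
    exact ⟨n, fun x hx => hn x hx.1⟩
  · exact lt_asymm hx.2.2 hx'.2.1
  · rcases lt_or_gt_of_ne (hgi.ne hne) with h | h
    · obtain ⟨k, hk⟩ := key x y hxy h
      exact ⟨k, Or.inl hk⟩
    · obtain ⟨k, hk⟩ := key y x hxy.symm h
      exact ⟨k, Or.inr hk⟩

/-- A Borel set meeting every class in at most one point is null when almost all classes are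
infinite. -/
theorem Graphing.ae_notMem_of_transversal [IsProbabilityMeasure μ] (hΦ : Φ.Aperiodic) {Y : Set X}
    (hY : MeasurableSet Y) (h : ∀ x ∈ Y, ∀ y ∈ Y, Φ.Rel x y → x = y) : ∀ᵐ x ∂μ, x ∉ Y := by
  obtain ⟨f, D, h1, h2, h3⟩ := Φ.exists_seq_presOn
  have hrel : ∀ k, ∀ x ∈ D k, Φ.Rel x (f k x) := by
    intro k x hx
    obtain ⟨n, hn⟩ := h2 k
    exact rel_of_d_ne_top (ne_top_of_le_ne_top (ENNReal.natCast_ne_top n) (hn x hx))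
  -- Points of Y at which `f k` gives a value not given by an earlier index. As Y meets each class
  -- at most once, the images `f k '' E k` are disjoint, so the measures of the `E k` are summable.
  -- By Borel–Cantelli almost every x is in finitely many `E k`, and a point of Y with this property
  -- has a finite class.
  let E : ℕ → Set X := fun k => {x | x ∈ Y ∧ x ∈ D k ∧ ∀ j < k, x ∈ D j → f j x ≠ f k x}
  have hE : ∀ k, MeasurableSet (E k) := by
    intro k
    have : E k = Y ∩ (D k ∩ ⋂ j, ⋂ _ : j < k, (D j ∩ {x | f j x = f k x})ᶜ) := by
      ext x
      simp only [E, mem_ofPred_eq, mem_inter_iff, mem_iInter, mem_compl_iff, not_and]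
    rw [this]
    exact hY.inter ((h1 k).measurableSet.inter (MeasurableSet.iInter fun j =>
      MeasurableSet.iInter fun _ => ((h1 j).measurableSet.inter
        (measurableSet_eq_fun (h1 j).measurable (h1 k).measurable)).compl))
  have hEI : ∀ k, MeasurableSet (f k '' E k) := fun k =>
    (hE k).image_of_measurable_injOn (h1 k).measurable ((h1 k).injOn.mono fun x hx => hx.2.1)
  have hdisj : Pairwise (Function.onFun Disjoint fun k => f k '' E k) := by
    have : ∀ k l, k < l → Disjoint (f k '' E k) (f l '' E l) := by
      intro k l hkl
      rw [disjoint_left]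
      rintro _ ⟨x, hx, rfl⟩ ⟨y, hy, e⟩
      have hr : Φ.Rel y (f k x) := e ▸ hrel l y hy.2.1
      have hxy : y = x := h y hy.1 x hx.1 (hr.trans _ _ _ ((hrel k x hx.2.1).symm))
      subst hxy
      exact hy.2.2 k hkl hx.2.1 e.symm
    intro k l hkl
    rcases lt_or_gt_of_ne hkl with hlt | hlt
    · exact this k l hlt
    · exact (this l k hlt).symm
  have hsum : ∑' k, μ (E k) ≠ ∞ := by
    have : ∀ k, μ (E k) = μ (f k '' E k) := fun k =>
      ((h1 k).measure_image _ (fun x hx => hx.2.1) (hE k)).symm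
    simp only [this]
    rw [← measure_iUnion hdisj hEI]
    exact measure_ne_top _ _
  have hBC := ae_eventually_notMem hsum
  filter_upwards [hBC, hΦ] with x hx hinf hxY
  refine hinf ?_
  obtain ⟨K, hK⟩ := eventually_atTop.1 hx
  refine ((finite_Iio K).image fun k => f k x).subset ?_
  intro y hy
  classical
  have hex := h3 x y hy
  refine ⟨Nat.find hex, ?_, (Nat.find_spec hex).2⟩
  by_contra hge
  refine hK (Nat.find hex) (not_lt.1 hge) ⟨hxY, (Nat.find_spec hex).1, fun j hj hjD hje => ?_⟩
  exact Nat.find_min hex hj ⟨hjD, hje.trans (Nat.find_spec hex).2⟩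

theorem PresOn.exists_inverse {f : X → X} {D : Set X} (h : PresOn μ f D) :
    ∃ g : X → X, PresOn μ g (f '' D) ∧ (∀ x ∈ D, g (f x) = x) ∧ ∀ x ∉ f '' D, g x = x := by
  classical
  let g : X → X := fun x => if hx : x ∈ f '' D then hx.choose else x
  have hg1 : ∀ x ∈ D, g (f x) = x := by
    intro x hx
    have hx' : f x ∈ f '' D := ⟨x, hx, rfl⟩
    simp only [g, dif_pos hx']
    exact h.injOn hx'.choose_spec.1 hx hx'.choose_spec.2
  have hg2 : ∀ x ∉ f '' D, g x = x := fun x hx => dif_neg hx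
  have him : ∀ B, MeasurableSet B → MeasurableSet (f '' (B ∩ D)) := fun B hB =>
    (hB.inter h.measurableSet).image_of_measurable_injOn h.measurable
      (h.injOn.mono inter_subset_right)
  have hfD : MeasurableSet (f '' D) := by simpa using him univ MeasurableSet.univ
  have hgm : Measurable g := by
    intro B hB
    have : g ⁻¹' B = f '' (B ∩ D) ∪ ((f '' D)ᶜ ∩ B) := by
      ext y
      by_cases hy : y ∈ f '' D
      · obtain ⟨x, hx, rfl⟩ := hy
        constructor
        · intro hB'
          exact Or.inl ⟨x, ⟨by simpa [hg1 x hx] using hB', hx⟩, rfl⟩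
        · rintro (⟨z, hz, e⟩ | hn)
          · have := h.injOn hz.2 hx e
            subst this
            simpa [hg1 z hx] using hz.1
          · exact absurd ⟨x, hx, rfl⟩ hn.1
      · constructor
        · intro hB'
          exact Or.inr ⟨hy, by simpa [hg2 y hy] using hB'⟩
        · rintro (⟨z, hz, e⟩ | hn)
          · exact absurd ⟨z, hz.2, e⟩ hy
          · simpa [hg2 y hy] using hn.2
    exact this ▸ (him B hB).union (hfD.compl.inter hB)
  refine ⟨g, ⟨hgm, hfD, ?_, fun B hB hBm => ?_⟩, hg1, hg2⟩
  · rintro _ ⟨x, hx, rfl⟩ _ ⟨y, hy, rfl⟩ e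
    rw [hg1 x hx, hg1 y hy] at e
    rw [e]
  · have e1 : g '' B = D ∩ f ⁻¹' B := by
      ext x
      constructor
      · rintro ⟨y, hy, rfl⟩
        obtain ⟨x, hx, rfl⟩ := hB hy
        rw [hg1 x hx]
        exact ⟨hx, hy⟩
      · rintro ⟨hx, hxB⟩
        exact ⟨f x, hxB, hg1 x hx⟩
    have e2 : f '' (D ∩ f ⁻¹' B) = B := by
      rw [image_inter_preimage, inter_eq_right.2 hB]
    rw [e1, ← h.measure_image _ inter_subset_left (h.measurableSet.inter (h.measurable hBm)), e2]

/-- The involution exchanging `D` and `f '' D`. -/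
theorem Graphing.exists_swap [IsProbabilityMeasure μ] {f : X → X} {D : Set X} (h : PresOn μ f D)
    {n : ℕ} (hd : ∀ x ∈ D, Φ.d x (f x) ≤ n) (hD : ∀ x ∈ D, f x ∉ D) :
    ∃ s : Φ.l1, (∀ x, s.1.1 (s.1.1 x) = x) ∧ (∀ x ∈ D, s.1.1 x = f x) ∧
      ∀ x ∉ D, x ∉ f '' D → s.1.1 x = x := by
  classical
  obtain ⟨g, hg, hg1, hg2⟩ := h.exists_inverse
  let s : X → X := fun x => if x ∈ D then f x else g x
  have s1 : ∀ x ∈ D, s x = f x := fun x hx => if_pos hx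
  have s2 : ∀ x ∉ D, s x = g x := fun x hx => if_neg hx
  have hfD : ∀ x ∈ f '' D, x ∉ D := by
    rintro _ ⟨x, hx, rfl⟩
    exact hD x hx
  have hs : Function.Involutive s := by
    intro x
    by_cases hx : x ∈ D
    · rw [s1 x hx, s2 _ (hD x hx), hg1 x hx]
    · by_cases hx' : x ∈ f '' D
      · obtain ⟨y, hy, rfl⟩ := hx'
        rw [s2 _ hx, hg1 y hy, s1 y hy]
      · have : s x = x := (s2 x hx).trans (hg2 x hx')
        rw [this, this]
  have hmem : hs.toPerm ∈ mpPerm μ := by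
    refine mem_mpPerm_of_cover (ι := Option Bool) _
      (f := fun o => o.elim (fun x => x) fun b => if b then f else g)
      (D := fun o => o.elim (D ∪ f '' D)ᶜ fun b => if b then D else f '' D) ?_ ?_ ?_
    · rintro (_ | _ | _)
      · exact PresOn.id (h.measurableSet.union hg.measurableSet).compl
      · exact hg
      · exact h
    · rintro (_ | _ | _) x hx
      · have hx' : ¬ (x ∈ D ∨ x ∈ f '' D) := hx
        rw [not_or] at hx'
        exact (s2 x hx'.1).trans (hg2 x hx'.2)
      · exact s2 x (hfD x hx)
      · exact s1 x hx
    · intro x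
      by_cases hx : x ∈ D
      · exact ⟨some true, hx⟩
      · by_cases hx' : x ∈ f '' D
        · exact ⟨some false, hx'⟩
        · refine ⟨none, ?_⟩
          change ¬ (x ∈ D ∨ x ∈ f '' D)
          exact not_or.2 ⟨hx, hx'⟩
  refine ⟨⟨⟨hs.toPerm, hmem⟩, ?_⟩, hs, s1, fun x hx hx' => (s2 x hx).trans (hg2 x hx')⟩
  rw [mem_l1_iff]
  have hle : ∀ x, Φ.d x (s x) ≤ n := by
    intro x
    by_cases hx : x ∈ D
    · rw [s1 x hx]
      exact hd x hx
    · by_cases hx' : x ∈ f '' D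
      · obtain ⟨y, hy, rfl⟩ := hx'
        rw [s2 _ hx, hg1 y hy, d_comm]
        exact hd y hy
      · rw [s2 x hx, hg2 x hx', d_self]
        exact bot_le
  refine ne_top_of_le_ne_top (b := ∫⁻ _, (n : ℝ≥0∞) ∂μ) ?_ (lintegral_mono hle)
  simp

end Words

/-! ### Involutions are limits of products of commutators -/

section Derived

open Filter Topology
open scoped commutatorElement

variable {X : Type*} [MeasurableSpace X] [StandardBorelSpace X] {μ : Measure X} {Φ : Graphing μ}

theorem Graphing.toL1_res_union {u : Φ.l1} (hu : ∀ x, u.1.1 (u.1.1 x) = x) {A E F : Set X}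
    (hA : ∀ x ∈ A, u.1.1 x ∉ A) (hE : MeasurableSet E) (hF : MeasurableSet F) (hEA : E ⊆ A)
    (hFA : F ⊆ A) (hEF : ∀ x ∈ E, x ∉ F) :
    Φ.toL1 (res u hu (E ∪ F) (hE.union hF)) =
      Φ.toL1 (res u hu E hE) * Φ.toL1 (res u hu F hF) := by
  rw [← map_mul]
  refine toL1_eq (Eventually.of_forall fun x => ?_)
  change resPerm u.1.1 hu (E ∪ F) x = resPerm u.1.1 hu E (resPerm u.1.1 hu F x)
  by_cases hxF : x ∈ F ∨ u.1.1 x ∈ F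
  · rw [resPerm_apply_of_mem hu hxF, resPerm_apply_of_mem hu (hxF.imp Or.inr Or.inr),
      resPerm_apply_of_notMem hu]
    rw [hu]
    rintro (h | h) <;> rcases hxF with h' | h'
    · exact hA x (hFA h') (hEA h)
    · exact hEF _ h h'
    · exact hEF _ h h'
    · exact hA x (hEA h) (hFA h')
  · rw [resPerm_apply_of_notMem hu hxF]
    by_cases hxE : x ∈ E ∨ u.1.1 x ∈ E
    · rw [resPerm_apply_of_mem hu hxE, resPerm_apply_of_mem hu (hxE.imp Or.inl Or.inl)]
    · rw [resPerm_apply_of_notMem hu hxE, resPerm_apply_of_notMem hu]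
      rw [not_or] at hxE hxF
      simp [hxE.1, hxE.2, hxF.1, hxF.2]

theorem Graphing.res_conj {u v : Φ.l1} (hu : ∀ x, u.1.1 (u.1.1 x) = x)
    (huv : ∀ x, u.1.1 (v.1.1 x) = v.1.1 (u.1.1 x)) {E F : Set X} (hE : MeasurableSet E)
    (hF : MeasurableSet F) (hEF : ∀ x, v.1.1 x ∈ F ↔ x ∈ E) :
    Φ.toL1 (res u hu F hF) = Φ.toL1 v * Φ.toL1 (res u hu E hE) * (Φ.toL1 v)⁻¹ := by
  rw [eq_mul_inv_iff_mul_eq, ← map_mul, ← map_mul]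
  refine toL1_eq (Eventually.of_forall fun x => ?_)
  change resPerm u.1.1 hu F (v.1.1 x) = v.1.1 (resPerm u.1.1 hu E x)
  by_cases hx : x ∈ E ∨ u.1.1 x ∈ E
  · rw [resPerm_apply_of_mem hu hx, resPerm_apply_of_mem hu, huv]
    rwa [huv, hEF, hEF]
  · rw [resPerm_apply_of_notMem hu hx, resPerm_apply_of_notMem hu]
    rwa [huv, hEF, hEF]

variable [IsProbabilityMeasure μ]

/-- Let s swap Z and f Z inside A. Its conjugate u s u acts off A, so it commutes with s, and v = s
(u s u) commutes with u and carries Z to f Z. Hence v conjugates the restriction of u over Z to the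
one over f Z. Their product is ⁅r, v⁆ with r the restriction over Z, because r⁻¹ = r. -/
theorem Graphing.res_union_image_mem_commutator {u : Φ.l1} (hu : ∀ x, u.1.1 (u.1.1 x) = x)
    {A Z : Set X} (hA : ∀ x ∈ A, u.1.1 x ∉ A) {f : X → X} (hf : PresOn μ f Z) {n : ℕ}
    (hd : ∀ x ∈ Z, Φ.d x (f x) ≤ n) (hZ : ∀ x ∈ Z, f x ∉ Z) (hZA : Z ⊆ A) (hfA : f '' Z ⊆ A)
    (hfZ : MeasurableSet (f '' Z)) :
    Φ.toL1 (res u hu (Z ∪ f '' Z) (hf.measurableSet.union hfZ)) ∈ commutator Φ.l1FullGroup := by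
  obtain ⟨s, hs, hs1, hs2⟩ := exists_swap hf hd hZ
  have hsA : ∀ x ∉ A, s.1.1 x = x := fun x hx => hs2 x (fun h => hx (hZA h)) fun h => hx (hfA h)
  have huA : ∀ x ∈ A, (u * s * u).1.1 x = x := by
    intro x hx
    change u.1.1 (s.1.1 (u.1.1 x)) = x
    rw [hsA _ (hA x hx), hu]
  have hcomm : Commute s.1.1 (u * s * u).1.1 := by
    refine Equiv.Perm.Disjoint.commute fun x => ?_
    by_cases hx : x ∈ A
    · exact Or.inr (huA x hx)
    · exact Or.inl (hsA x hx)
  have hc : ∀ x, s.1.1 (u.1.1 (s.1.1 (u.1.1 x))) = u.1.1 (s.1.1 (u.1.1 (s.1.1 x))) := fun x =>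
    congrArg (fun e : Equiv.Perm X => e x) hcomm.eq
  set v : Φ.l1 := s * (u * s * u)
  have hv : ∀ x, v.1.1 x = s.1.1 (u.1.1 (s.1.1 (u.1.1 x))) := fun x => rfl
  have hvZ : ∀ x ∈ Z, v.1.1 x = f x := by
    intro x hx
    change s.1.1 ((u * s * u).1.1 x) = f x
    rw [huA x (hZA hx), hs1 x hx]
  have huv : ∀ x, u.1.1 (v.1.1 x) = v.1.1 (u.1.1 x) := by
    intro x
    rw [hv, hv, hc, hu, hu]
  have hEF : ∀ x, v.1.1 x ∈ f '' Z ↔ x ∈ Z := by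
    intro x
    constructor
    · rintro ⟨z, hz, e⟩
      rw [← hvZ z hz] at e
      exact v.1.1.injective e ▸ hz
    · intro hx
      exact ⟨x, hx, (hvZ x hx).symm⟩
  rw [toL1_res_union hu hA hf.measurableSet hfZ hZA hfA fun x hx => ?_,
    res_conj hu huv hf.measurableSet hfZ hEF]
  · have hinv : (Φ.toL1 (res u hu Z hf.measurableSet))⁻¹ = Φ.toL1 (res u hu Z hf.measurableSet) :=
      inv_eq_of_mul_eq_one_left (toL1_mul_self (resPerm_resPerm hu _))
    have : Φ.toL1 (res u hu Z hf.measurableSet) *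
        (Φ.toL1 v * Φ.toL1 (res u hu Z hf.measurableSet) * (Φ.toL1 v)⁻¹) =
        ⁅Φ.toL1 (res u hu Z hf.measurableSet), Φ.toL1 v⁆ := by
      rw [commutatorElement_def, hinv]
      simp only [mul_assoc]
    rw [this, commutator_def]
    exact Subgroup.commutator_mem_commutator trivial trivial
  · rintro ⟨z, hz, rfl⟩
    exact hZ z hz hx

/-- Greedy pairing inside A: at stage k, the points of `Y k` sent by `f k` into `Y k` are removed
together with their images. The restriction of u over the removed part is a product of commutators,
and tends to u once the remainder shrinks to a null set. -/
theorem Graphing.mem_closure_commutator_of_involutive (hΦ : Φ.Aperiodic) {u : Φ.l1}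
    (hu : ∀ x, u.1.1 (u.1.1 x) = x) :
    Φ.toL1 u ∈ closure (commutator Φ.l1FullGroup : Set Φ.l1FullGroup) := by
  obtain ⟨f, D, h1, h2, h3, h4⟩ := Φ.exists_seq_disjoint
  obtain ⟨g, hg, hgi, -⟩ := exists_injective_measurable_real X
  let A : Set X := {x | g x < g (u.1.1 x)}
  have hAm : MeasurableSet A := measurableSet_lt hg (hg.comp (measurable_val u.1))
  have hA : ∀ x ∈ A, u.1.1 x ∉ A := by
    intro x hx hx'
    have h : g (u.1.1 x) < g (u.1.1 (u.1.1 x)) := hx'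
    rw [hu] at h
    exact lt_asymm h hx
  let Z : ℕ → Set X → Set X := fun k Y => Y ∩ (D k ∩ f k ⁻¹' Y)
  let Y : ℕ → Set X := fun n => Nat.rec A (fun k Y => Y \ (Z k Y ∪ f k '' Z k Y)) n
  have hYs : ∀ k, Y (k + 1) = Y k \ (Z k (Y k) ∪ f k '' Z k (Y k)) := fun k => rfl
  have hZm : ∀ k W, MeasurableSet W → MeasurableSet (Z k W) := fun k W hW =>
    hW.inter ((h1 k).measurableSet.inter ((h1 k).measurable hW))
  have hZP : ∀ k W, MeasurableSet W → PresOn μ (f k) (Z k W) := fun k W hW =>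
    (h1 k).mono (hZm k W hW) fun x hx => hx.2.1
  have hZI : ∀ k W, MeasurableSet W → MeasurableSet (f k '' Z k W) := fun k W hW =>
    (hZm k W hW).image_of_measurable_injOn (h1 k).measurable (hZP k W hW).injOn
  have hfZ : ∀ k W, f k '' Z k W ⊆ W := by
    rintro k W _ ⟨x, hx, rfl⟩
    exact hx.2.2
  have hYm : ∀ k, MeasurableSet (Y k) := by
    intro k
    induction k with
    | zero => exact hAm
    | succ k ih => exact ih.diff ((hZm k _ ih).union (hZI k _ ih))
  have hYa : Antitone Y := antitone_nat_of_succ_le fun k => sdiff_subset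
  have hYA : ∀ k, Y k ⊆ A := fun k => hYa (Nat.zero_le k)
  have hnull : ∀ᵐ x ∂μ, ∃ k, x ∉ Y k := by
    have := ae_notMem_of_transversal hΦ (Y := ⋂ k, Y k) (MeasurableSet.iInter hYm) ?_
    · filter_upwards [this] with x hx
      simpa using hx
    · have key : ∀ k x, x ∈ ⋂ k, Y k → f k x ∈ ⋂ k, Y k → x ∉ D k := by
        intro k x hx hfx hxD
        rw [mem_iInter] at hx hfx
        have := hx (k + 1)
        rw [hYs] at this
        exact this.2 (Or.inl ⟨hx k, hxD, hfx k⟩)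
      intro x hx y hy hxy
      by_contra hne
      obtain ⟨k, ⟨hk, rfl⟩ | ⟨hk, rfl⟩⟩ := h4 x y hxy hne
      · exact key k x hx hy hk
      · exact key k y hy hx hk
  have hmem : ∀ k, Φ.toL1 (res u hu (A \ Y k) (hAm.diff (hYm k))) ∈
      commutator Φ.l1FullGroup := by
    intro k
    induction k with
    | zero =>
      have : Φ.toL1 (res u hu (A \ Y 0) (hAm.diff (hYm 0))) = 1 := by
        rw [← map_one Φ.toL1]
        refine toL1_eq (Eventually.of_forall fun x => resPerm_apply_of_notMem hu ?_)
        have : A \ Y 0 = ∅ := Set.sdiff_self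
        simp [this]
      rw [this]
      exact one_mem _
    | succ k ih =>
      obtain ⟨n, hn⟩ := h2 k
      have hU := (hZm k _ (hYm k)).union (hZI k _ (hYm k))
      have hUY : Z k (Y k) ∪ f k '' Z k (Y k) ⊆ Y k :=
        union_subset inter_subset_left (hfZ k _)
      have hset : A \ Y (k + 1) = (A \ Y k) ∪ (Z k (Y k) ∪ f k '' Z k (Y k)) := by
        ext x
        have h5 : x ∈ Z k (Y k) ∪ f k '' Z k (Y k) → x ∈ Y k := fun h => hUY h
        have h6 : x ∈ Y k → x ∈ A := fun h => hYA k h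
        rw [hYs, mem_union, Set.mem_sdiff, Set.mem_sdiff, Set.mem_sdiff]
        rcases em (x ∈ Z k (Y k) ∪ f k '' Z k (Y k)) with hP | hP
        · exact iff_of_true ⟨h6 (h5 hP), fun h => h.2 hP⟩ (Or.inr hP)
        · constructor
          · rintro ⟨a, b⟩
            exact Or.inl ⟨a, fun hy => b ⟨hy, hP⟩⟩
          · rintro (⟨a, b⟩ | c)
            · exact ⟨a, fun h => b h.1⟩
            · exact absurd c hP
      have hres : res u hu (A \ Y (k + 1)) (hAm.diff (hYm (k + 1))) =
          res u hu ((A \ Y k) ∪ (Z k (Y k) ∪ f k '' Z k (Y k)))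
            ((hAm.diff (hYm k)).union hU) := by
        congr 1
      rw [hres, toL1_res_union hu hA (hAm.diff (hYm k)) hU sdiff_subset (hUY.trans (hYA k))
        fun x hx hx' => hx.2 (hUY hx')]
      exact mul_mem ih (res_union_image_mem_commutator hu hA (hZP k _ (hYm k))
        (fun x hx => hn x hx.2.1) (fun x hx hx' => h3 k x hx.2.1 hx'.2.1)
        (inter_subset_left.trans (hYA k)) ((hfZ k _).trans (hYA k)) (hZI k _ (hYm k)))
  refine mem_closure_of_tendsto (f := fun k => Φ.toL1 (res u hu (A \ Y k) (hAm.diff (hYm k))))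
    (b := atTop) (tendsto_toL1 (b := fun x => Φ.d x (u.1.1 x)) (mem_l1_iff.1 u.2) ?_ ?_)
    (Eventually.of_forall hmem)
  · intro k x
    have h := d_res_le u hu (hAm.diff (hYm k)) MeasurableSet.univ x
    rwa [show (res u hu univ MeasurableSet.univ).1.1 x = u.1.1 x from
      resPerm_apply_of_mem hu (Or.inl trivial)] at h
  · filter_upwards [hnull, u.1.2.1.quasiMeasurePreserving.ae hnull] with x ⟨k, hk⟩ ⟨l, hl⟩
    filter_upwards [eventually_ge_atTop (max k l)] with m hm
    have hxm : x ∉ Y m := fun h => hk (hYa (le_of_max_le_left hm) h)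
    have hum : u.1.1 x ∉ Y m := fun h => hl (hYa (le_of_max_le_right hm) h)
    rcases em (x ∈ A \ Y m ∨ u.1.1 x ∈ A \ Y m) with hx | hx
    · exact resPerm_apply_of_mem hu hx
    · refine (resPerm_apply_of_notMem hu hx).trans ?_
      rw [not_or] at hx
      have hx1 : ¬ g x < g (u.1.1 x) := fun h => hx.1 ⟨h, hxm⟩
      have hx2 : ¬ g (u.1.1 x) < g (u.1.1 (u.1.1 x)) := fun h => hx.2 ⟨h, hum⟩
      rw [hu] at hx2
      exact hgi (le_antisymm (not_lt.1 hx2) (not_lt.1 hx1))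

theorem Graphing.closure_commutator_eq (hΦ : Φ.Aperiodic) :
    closure (commutator Φ.l1FullGroup : Set Φ.l1FullGroup) =
      closure (Φ.involutionSubgroup : Set Φ.l1FullGroup) := by
  apply Subset.antisymm
  · refine closure_minimal ?_ isClosed_closure
    exact commutator_le_closure_involutionSubgroup
  · refine closure_minimal ?_ isClosed_closure
    have : Φ.involutionSubgroup ≤ (commutator Φ.l1FullGroup).topologicalClosure := by
      refine (Subgroup.closure_le _).2 fun U hU => ?_
      obtain ⟨u, hu, rfl⟩ := exists_involutive_lift hU
      exact mem_closure_commutator_of_involutive hΦ hu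
    exact this

end Derived

end L1Full

theorem mainTheorem8 {X : Type*} [MeasurableSpace X] [StandardBorelSpace X]
    (μ : MeasureTheory.Measure X) [MeasureTheory.IsProbabilityMeasure μ]
    [MeasureTheory.NullSingletonClass μ] (Φ : L1Full.Graphing μ) (hΦ : Φ.Aperiodic) :
    -- the closure of the derived group is the closure of the subgroup generated by involutions
    closure (commutator Φ.l1FullGroup : Set Φ.l1FullGroup) =
      closure (Subgroup.closure {U : Φ.l1FullGroup | U * U = 1} : Set Φ.l1FullGroup) ∧
    -- it is connected
    IsConnected (closure (commutator Φ.l1FullGroup : Set Φ.l1FullGroup)) ∧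
    -- each involution is joined to the identity by a continuous path of induced involutions
    ∀ U : Φ.l1FullGroup, U * U = 1 →
      ∃ γ : Path (1 : Φ.l1FullGroup) U, ∀ t : unitInterval,
        γ t * γ t = 1 ∧
        ∃ A : Set X, MeasurableSet A ∧ L1Full.IsInduced (U : L1Full.MAut μ) A (γ t) := by
  have h := L1Full.Graphing.closure_commutator_eq hΦ
  refine ⟨h, ?_, fun U hU => L1Full.Graphing.exists_path hU⟩
  rw [h]
  exact L1Full.Graphing.isPathConnected_involutionSubgroup.isConnected.closure
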